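/- All Hilbert spaces are finite-dimensional and complex. A state on $\mathcal H$ is a positive semidefinite operator of trace one; the fidelity is $F(\rho,\sigma)=\operatorname{Tr}\sqrt{\sqrt\rho\,\sigma\sqrt\rho}$. An *admissible product operation* is a map $\Phi_A\otimes\Phi_B$ where each factor has the form $X\mapsto\sum_j M_jXM_j^\dagger$ (finite sum) with $\sum_j M_j^\dagger M_j=I$. For a measurement $\{P_s\}_{s\in S}$ on $\mathcal Z$ ($S$ finite, $P_s\ge 0$, $\sum_sP_s=I$), the Alice-to-Bob *measurement transmission* is the map taking operators on $(\mathcal H_A\otimes\mathcal Z)\otimes\mathcal H_B$ to operators on $\mathcal H_A\otimes(\mathcal H_B\otimes\mathbb C^{S})$ given by $X\mapsto\sum_{s}\operatorname{Tr}_{\mathcal Z}[(I\otimes P_s\otimes I)X]\otimes|s\rangle\langle s|$; the Bob-to-Alice one is defined symmetrically. An *LOCC super-operator* is a finite composition of admissible product operations and measurement transmissions in either direction. Let $\tau=\frac12(|00\rangle+|11\rangle)(\langle00|+\langle11|)$ on $\mathbb C^2\otimes\mathbb C^2$. The *distillable entanglement* $E_d(\rho)$ of a state $\rho$ on $\mathcal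 H_A\otimes\mathcal H_B$ is the supremum of all real $\alpha\ge0$ for which there are LOCC super-operators $\Phi_n$ from $\mathcal H_A^{\otimes n}\otimes\mathcal H_B^{\otimes n}$ to $(\mathbb C^2)^{\otimes\lfloor\alpha n\rfloor}\otimes(\mathbb C^2)^{\otimes\lfloor\alpha n\rfloor}$ with $\lim_{n\to\infty}F(\Phi_n(\rho^{\otimes n}),\tau^{\otimes\lfloor\alpha n\rfloor})=1$. A finite family $\{\rho_a\}_{a\in\Sigma}$ of states on $\mathcal H_A\otimes\mathcal H_B$ is *locally orthogonal* if it can be ordered as $\rho_{a_1},\dots,\rho_{a_K}$, $K=|\Sigma|$, so that for each $q$ there is a subsystem $l\in\{A,B\}$ with $\operatorname{Tr}[(\rho_{a_q})_l(\rho_{a_n})_l]=0$ for all $n>q$, where $(\cdot)_l$ denotes the reduced state on subsystem $l$. **Theorem 3.4.** Let $\{\rho_a\}_{a\in\Sigma}$ be a locally orthogonal finite family of states on $\mathcal H_A\otimes\mathcal H_B$, let $p=(p_a)_{a\in\Sigma}$ be a probability distribution, and let $\rho=\sum_{a\in\Sigma}p_a\rho_a$. Then $$E_d(\rho)\ \ge\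 \sum_{a\in\Sigma}p_a\,E_d(\rho_a).$$ -/

import Mathlib

open scoped NNReal ENNReal Kronecker ComplexOrder MatrixOrder

/- Throughout, a finite-dimensional complex Hilbert space is `ℂ^A` for a finite type `A` (the index
set of an orthonormal basis); `ℂ^A ⊗ ℂ^B` is `ℂ^(A × B)`, and a linear operator on it is a
`Matrix (A × B) (A × B) ℂ`. In `A × B` the first factor belongs to Alice, the second to Bob. -/

namespace Entanglement

/-- A quantum state (density operator) on `ℂ^A`: positive semidefinite of trace one. -/
def IsState {A : Type} [Fintype A] (ρ : Matrix A A ℂ) : Prop :=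
  ρ.PosSemidef ∧ ρ.trace = 1

/-- The fidelity `F(ρ, σ) = Tr √(√ρ σ √ρ)`. -/
noncomputable def fidelity {A : Type} [Fintype A] [DecidableEq A] (ρ σ : Matrix A A ℂ) : ℝ :=
  (CFC.sqrt (CFC.sqrt ρ * σ * CFC.sqrt ρ)).trace.re

/-- The reduced operator `Tr_B ρ` on Alice's space. -/
def reducedA {A B : Type} [Fintype B] (ρ : Matrix (A × B) (A × B) ℂ) : Matrix A A ℂ :=
  Matrix.of fun a a' => ∑ b, ρ (a, b) (a', b)

/-- The reduced operator `Tr_A ρ` on Bob's space. -/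
def reducedB {A B : Type} [Fintype A] (ρ : Matrix (A × B) (A × B) ℂ) : Matrix B B ℂ :=
  Matrix.of fun b b' => ∑ a, ρ (a, b) (a, b')

/-- A finite family of bipartite operators is locally orthogonal if it can be listed as
`ρ_{a_1}, …, ρ_{a_K}` so that for each `q` there is one of the two subsystems on which the reduced
operator of `ρ_{a_q}` is orthogonal (in the trace inner product) to the reduced operators of all
later members `ρ_{a_n}`, `n > q`. The subsystem may depend on `q`, but not on `n`. -/
def LocallyOrthogonal {S A B : Type} [Fintype S] [Fintype A] [Fintype B]
    (ρ : S → Matrix (A × B) (A × B) ℂ) : Prop :=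
  ∃ e : Fin (Fintype.card S) ≃ S, ∀ q,
    (∀ n, q < n → (reducedA (ρ (e q)) * reducedA (ρ (e n))).trace = 0) ∨
    (∀ n, q < n → (reducedB (ρ (e q)) * reducedB (ρ (e n))).trace = 0)

/-- The super-operator `X ↦ ∑ j, M j X (M j)†` with Kraus operators `M j`. -/
def krausMap {J A A' : Type} [Fintype J] [Fintype A] (M : J → Matrix A' A ℂ) :
    Matrix A A ℂ →ₗ[ℂ] Matrix A' A' ℂ where
  toFun X := ∑ j, M j * X * (M j).conjTranspose
  map_add' X Y := by simp [Matrix.mul_add, Matrix.add_mul, Finset.sum_add_distrib]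
  map_smul' c X := by simp [Finset.smul_sum]

/-- The Kraus operators define an admissible (trace-preserving) quantum operation:
`∑ j, (M j)† M j = 1`. -/
def IsAdmissible {J A A' : Type} [Fintype J] [Fintype A'] [DecidableEq A]
    (M : J → Matrix A' A ℂ) : Prop :=
  ∑ j, (M j).conjTranspose * M j = 1

/-- The tensor product of the operations with Kraus operators `M j` and `N k`. -/
def productMap {J K A A' B B' : Type} [Fintype J] [Fintype K] [Fintype A] [Fintype B]
    (M : J → Matrix A' A ℂ) (N : K → Matrix B' B ℂ) :
    Matrix (A × B) (A × B) ℂ →ₗ[ℂ] Matrix (A' × B') (A' × B') ℂ :=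
  krausMap fun jk : J × K => M jk.1 ⊗ₖ N jk.2

theorem productMap_kronecker {J K A A' B B' : Type} [Fintype J] [Fintype K] [Fintype A]
    [Fintype B] (M : J → Matrix A' A ℂ) (N : K → Matrix B' B ℂ) (X : Matrix A A ℂ)
    (Y : Matrix B B ℂ) : productMap M N (X ⊗ₖ Y) = krausMap M X ⊗ₖ krausMap N Y := by
  ext ⟨a, b⟩ ⟨a', b'⟩
  simp only [productMap, krausMap, LinearMap.coe_mk, AddHom.coe_mk, Fintype.sum_prod_type,
    Matrix.conjTranspose_kronecker, ← Matrix.mul_kronecker_mul, Matrix.sum_apply,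
    Matrix.kroneckerMap_apply, Finset.sum_mul_sum]

/-- A measurement on `ℂ^Z` with outcomes in `S`. -/
def IsMeasurement {S Z : Type} [Fintype S] [Fintype Z] [DecidableEq Z]
    (P : S → Matrix Z Z ℂ) : Prop :=
  (∀ s, (P s).PosSemidef) ∧ ∑ s, P s = 1

/-- Alice measures her subsystem `ℂ^Z` with `P` and sends the outcome to Bob, who stores it in a
new register `ℂ^S`: `X ↦ ∑ s, Tr_Z[(1 ⊗ P s ⊗ 1) X] ⊗ |s⟩⟨s|`. -/
def transmitAB {S Z A B : Type} [DecidableEq S] [Fintype Z] (P : S → Matrix Z Z ℂ) :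
    Matrix ((A × Z) × B) ((A × Z) × B) ℂ →ₗ[ℂ] Matrix (A × (B × S)) (A × (B × S)) ℂ where
  toFun X := Matrix.of fun x y =>
    if x.2.2 = y.2.2 then
      ∑ z, ∑ w, P x.2.2 z w * X ((x.1, w), x.2.1) ((y.1, z), y.2.1)
    else 0
  map_add' X Y := by
    ext x y
    by_cases h : x.2.2 = y.2.2 <;> simp [h, mul_add, Finset.sum_add_distrib]
  map_smul' c X := by
    ext x y
    by_cases h : x.2.2 = y.2.2 <;> simp [h, Finset.mul_sum, mul_left_comm]

/-- Bob measures his subsystem `ℂ^Z` with `P` and sends the outcome to Alice, who stores it in a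
new register `ℂ^S`: `X ↦ ∑ s, Tr_Z[(1 ⊗ 1 ⊗ P s) X] ⊗ |s⟩⟨s|`. -/
def transmitBA {S Z A B : Type} [DecidableEq S] [Fintype Z] (P : S → Matrix Z Z ℂ) :
    Matrix (A × (B × Z)) (A × (B × Z)) ℂ →ₗ[ℂ] Matrix ((A × S) × B) ((A × S) × B) ℂ where
  toFun X := Matrix.of fun x y =>
    if x.1.2 = y.1.2 then
      ∑ z, ∑ w, P x.1.2 z w * X (x.1.1, (x.2, w)) (y.1.1, (y.2, z))
    else 0
  map_add' X Y := by
    ext x y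
    by_cases h : x.1.2 = y.1.2 <;> simp [h, mul_add, Finset.sum_add_distrib]
  map_smul' c X := by
    ext x y
    by_cases h : x.1.2 = y.1.2 <;> simp [h, Finset.mul_sum, mul_left_comm]

/-- LOCC super-operators: finite compositions of admissible product operations and measurement
transmissions in either direction, through arbitrary finite-dimensional intermediate spaces. -/
inductive IsLOCC : ∀ {A B A' B' : Type},
    (Matrix (A × B) (A × B) ℂ →ₗ[ℂ] Matrix (A' × B') (A' × B') ℂ) → Prop
  | product {A B A' B' J K : Type} [Fintype A] [Fintype B] [Fintype A'] [Fintype B']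
      [Fintype J] [Fintype K] [DecidableEq A] [DecidableEq B]
      (M : J → Matrix A' A ℂ) (N : K → Matrix B' B ℂ)
      (hM : IsAdmissible M) (hN : IsAdmissible N) : IsLOCC (productMap M N)
  | transmitAB {A B S Z : Type} [Fintype A] [Fintype B] [Fintype S] [Fintype Z]
      [DecidableEq S] [DecidableEq Z] (P : S → Matrix Z Z ℂ) (hP : IsMeasurement P) :
      IsLOCC (transmitAB (A := A) (B := B) P)
  | transmitBA {A B S Z : Type} [Fintype A] [Fintype B] [Fintype S] [Fintype Z]
      [DecidableEq S] [DecidableEq Z] (P : S → Matrix Z Z ℂ) (hP : IsMeasurement P) :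
      IsLOCC (transmitBA (A := A) (B := B) P)
  | comp {A B A' B' A'' B'' : Type}
      (Φ : Matrix (A × B) (A × B) ℂ →ₗ[ℂ] Matrix (A' × B') (A' × B') ℂ)
      (Ψ : Matrix (A' × B') (A' × B') ℂ →ₗ[ℂ] Matrix (A'' × B'') (A'' × B'') ℂ)
      (hΦ : IsLOCC Φ) (hΨ : IsLOCC Ψ) : IsLOCC (Ψ ∘ₗ Φ)

/-- `ρ^{⊗n}`, as an operator on `(ℂ^A)^{⊗n} ⊗ (ℂ^B)^{⊗n}`. -/
def tensorPower {A B : Type} (ρ : Matrix (A × B) (A × B) ℂ) (n : ℕ) :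
    Matrix ((Fin n → A) × (Fin n → B)) ((Fin n → A) × (Fin n → B)) ℂ :=
  Matrix.of fun x y => ∏ i, ρ (x.1 i, x.2 i) (y.1 i, y.2 i)

/-- The maximally entangled two-qubit state `τ = ½ (|00⟩ + |11⟩)(⟨00| + ⟨11|)`. -/
noncomputable def tau : Matrix (Fin 2 × Fin 2) (Fin 2 × Fin 2) ℂ :=
  (1 / 2 : ℂ) • (Matrix.single (0, 0) (0, 0) 1 + Matrix.single (0, 0) (1, 1) 1 +
    Matrix.single (1, 1) (0, 0) 1 + Matrix.single (1, 1) (1, 1) 1)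

/-- `α` is an achievable distillation rate for `ρ`: some sequence of LOCC super-operators takes
`ρ^{⊗n}` to `τ^{⊗⌊α n⌋}` with fidelity tending to one. -/
def IsDistillationRate {A B : Type} (ρ : Matrix (A × B) (A × B) ℂ) (α : ℝ≥0) : Prop :=
  ∃ Φ : ∀ n : ℕ, Matrix ((Fin n → A) × (Fin n → B)) ((Fin n → A) × (Fin n → B)) ℂ →ₗ[ℂ]
      Matrix ((Fin ⌊α * n⌋₊ → Fin 2) × (Fin ⌊α * n⌋₊ → Fin 2))
        ((Fin ⌊α * n⌋₊ → Fin 2) × (Fin ⌊α * n⌋₊ → Fin 2)) ℂ,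
    (∀ n, IsLOCC (Φ n)) ∧
    Filter.Tendsto (fun n => fidelity (Φ n (tensorPower ρ n)) (tensorPower tau ⌊α * n⌋₊))
      Filter.atTop (nhds 1)

/-- The distillable entanglement: the supremum of all achievable distillation rates, taken in
`[0, ∞]` so that it is a true supremum. -/
noncomputable def distillableEntanglement {A B : Type} (ρ : Matrix (A × B) (A × B) ℂ) : ℝ≥0∞ :=
  ⨆ (α : ℝ≥0) (_ : IsDistillationRate ρ α), (α : ℝ≥0∞)

end Entanglement

/-!
The proof is a protocol. For two states whose reduced states on Alice's side are orthogonal, the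
projection onto the support of one reduced state is a measurement of Alice which identifies the
state of a copy without disturbing it (`exists_discriminating_measurement`). Given `n` copies of
the mixture, Alice measures each copy and sends the list of outcomes to Bob; both permute their
factors so that copies of the same state stand together, and discard what is left over
(`exists_isLOCC_sort`). By Chebyshev's inequality the mixture with weights `p + q = 1` contains at
least `(p - δ) n` copies of the first state and `(q - δ) n` of the second with probability tending
to one (`le_sum_typical`). The two blocks are then distilled separately, and the pairs obtained are
pooled (`exists_isLOCC_distill_mixture`). Hence every rate below the weighted sum of two achievable
rates is achievable (`isDistillationRate_mixture`). The case of orthogonality on Bob's side follows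
by exchanging the parties, and the general case by induction on the number of states: the first
state in the order of local orthogonality is orthogonal, on one fixed side, to the normalized
mixture of all later ones (`sum_le_distillableEntanglement`).

Fidelities are handled through the overlap `Tr(X τ^{⊗k})`. As `τ^{⊗k}` is pure, the overlap is the
square of the fidelity (`fidelity_eq_sqrt_overlap`), but it is linear in `X`, so that the output on
the mixture can be estimated from below by the contribution of the typical label sequences alone.
For this one needs that local operations are positive and preserve the trace (`IsLOCC.posSemidef`,
`IsLOCC.trace_eq`), and that they may be applied to parts of a larger system
(`exists_isLOCC_bipartiteProd`).
-/

namespace Entanglement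

open Matrix

/-! ### Local operations: positivity, trace, symmetry, ancillas -/

/-- The spaces that occur in a local operation are finite-dimensional; in a composition this gives
the finiteness of the intermediate space. -/
theorem IsLOCC.finite {A B A' B' : Type}
    {Φ : Matrix (A × B) (A × B) ℂ →ₗ[ℂ] Matrix (A' × B') (A' × B') ℂ} (h : IsLOCC Φ) :
    (Finite A ∧ Finite B) ∧ Finite A' ∧ Finite B' := by
  induction h with
  | product => exact ⟨⟨inferInstance, inferInstance⟩, inferInstance, inferInstance⟩
  | transmitAB => exact ⟨⟨inferInstance, inferInstance⟩, inferInstance, inferInstance⟩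
  | transmitBA => exact ⟨⟨inferInstance, inferInstance⟩, inferInstance, inferInstance⟩
  | comp _ _ _ _ h₁ h₂ => exact ⟨h₁.1, h₂.2⟩

/-- Exchange of the roles of Alice and Bob, on operators. -/
def swapOp (A B : Type) : Matrix (A × B) (A × B) ℂ →ₗ[ℂ] Matrix (B × A) (B × A) ℂ where
  toFun X := X.submatrix Prod.swap Prod.swap
  map_add' _ _ := rfl
  map_smul' _ _ := rfl

theorem swapOp_apply {A B : Type} (X : Matrix (A × B) (A × B) ℂ) :
    swapOp A B X = X.submatrix Prod.swap Prod.swap := rfl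

theorem IsLOCC.swap {A B A' B' : Type}
    {Φ : Matrix (A × B) (A × B) ℂ →ₗ[ℂ] Matrix (A' × B') (A' × B') ℂ} (h : IsLOCC Φ) :
    IsLOCC (swapOp A' B' ∘ₗ Φ ∘ₗ swapOp B A) := by
  induction h with
  | @product A B A' B' J K _ _ _ _ _ _ _ _ M N hM hN =>
    convert IsLOCC.product N M hN hM using 1
    ext X ⟨b, a⟩ ⟨b', a'⟩
    simp only [productMap, krausMap, LinearMap.comp_apply, LinearMap.coe_mk, AddHom.coe_mk,
      swapOp_apply, submatrix_apply, Matrix.sum_apply, Prod.swap_prod_mk, mul_apply,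
      conjTranspose_apply, kroneckerMap_apply]
    rw [← (Equiv.prodComm K J).sum_comp]
    refine Finset.sum_congr rfl fun j _ => ?_
    rw [← (Equiv.prodComm B A).sum_comp]
    refine Finset.sum_congr rfl fun x _ => ?_
    rw [← (Equiv.prodComm B A).sum_comp]
    congr 1
    · refine Finset.sum_congr rfl fun x _ => ?_
      simp [mul_comm]
    · simp [mul_comm]
  | transmitAB P hP => exact IsLOCC.transmitBA P hP
  | transmitBA P hP => exact IsLOCC.transmitAB P hP
  | comp Φ Ψ _ _ h₁ h₂ => exact IsLOCC.comp (_ ∘ₗ Φ ∘ₗ _) (_ ∘ₗ Ψ ∘ₗ _) h₁ h₂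

/-- The Kraus operators of the measurement transmission, when `P s = (C s)† C s`. -/
def transmitKraus {S Z : Type} (A B : Type) [DecidableEq S] [DecidableEq A] [DecidableEq B]
    (C : S → Matrix Z Z ℂ) (s : S) (z : Z) : Matrix (A × (B × S)) ((A × Z) × B) ℂ :=
  Matrix.of fun x u => if u.1.1 = x.1 then if u.2 = x.2.1 then if s = x.2.2 then C s z u.1.2 else 0
    else 0 else 0

/-- A measurement transmission has a Kraus representation, and is therefore positive. -/
theorem transmitAB_eq_kraus {A B S Z : Type} [Fintype A] [Fintype B] [Fintype S] [Fintype Z]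
    [DecidableEq S] [DecidableEq A] [DecidableEq B]
    (C : S → Matrix Z Z ℂ) (X : Matrix ((A × Z) × B) ((A × Z) × B) ℂ) :
    transmitAB (fun s => (C s)ᴴ * C s) X =
      ∑ s, ∑ z, transmitKraus A B C s z * X * (transmitKraus A B C s z)ᴴ := by
  ext ⟨a, b, s⟩ ⟨a', b', s'⟩
  simp only [transmitAB, LinearMap.coe_mk, AddHom.coe_mk, of_apply, Matrix.sum_apply, mul_apply,
    conjTranspose_apply, transmitKraus, Fintype.sum_prod_type]
  have h (f : A → Z → B → ℂ) (a : A) (b : B) (p : Prop) [Decidable p] (g : Z → ℂ) :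
      ∑ x, ∑ w, ∑ y, (if x = a then if y = b then if p then g w else 0 else 0 else 0) * f x w y =
        if p then ∑ w, g w * f a w b else 0 := by
    by_cases hp : p <;> simp [hp, Finset.sum_ite_irrel]
  have h' (f : A → Z → B → ℂ) (a : A) (b : B) (p : Prop) [Decidable p] (g : Z → ℂ) :
      ∑ x, ∑ w, ∑ y, f x w y * star (if x = a then if y = b then if p then g w else 0 else 0 else 0)
        = if p then ∑ w, f a w b * star (g w) else 0 := by
    by_cases hp : p <;> simp [hp, Finset.sum_ite_irrel, apply_ite (starRingEnd ℂ)]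
  simp only [h, h']
  by_cases hs : s = s'
  · subst hs
    simp only [if_true, Finset.sum_ite_irrel, Finset.sum_const_zero, Finset.sum_ite_eq',
      Finset.mem_univ, Finset.sum_mul]
    symm
    rw [Finset.sum_comm]
    refine Finset.sum_congr rfl fun z _ => ?_
    rw [Finset.sum_comm]
    refine Finset.sum_congr rfl fun w _ => Finset.sum_congr rfl fun j _ => ?_
    ring
  · rw [if_neg hs]
    symm
    refine Finset.sum_eq_zero fun t _ => Finset.sum_eq_zero fun z _ => ?_
    by_cases ht : t = s'
    · simp [ht, Ne.symm hs]
    · simp [ht]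

theorem posSemidef_krausMap {J A A' : Type} [Fintype J] [Fintype A] [Finite A']
    (M : J → Matrix A' A ℂ) {X : Matrix A A ℂ} (hX : X.PosSemidef) :
    (krausMap M X).PosSemidef :=
  posSemidef_sum _ fun j _ => hX.mul_mul_conjTranspose_same (M j)

theorem trace_krausMap {J A A' : Type} [Fintype J] [Fintype A] [Fintype A'] [DecidableEq A]
    {M : J → Matrix A' A ℂ} (hM : IsAdmissible M) (X : Matrix A A ℂ) :
    (krausMap M X).trace = X.trace := by
  simp only [krausMap, LinearMap.coe_mk, AddHom.coe_mk, trace_sum]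
  simp_rw [fun j => trace_mul_cycle (M j) X (M j)ᴴ]
  rw [← trace_sum, ← Finset.sum_mul, hM, one_mul]

theorem IsAdmissible.kronecker {J K A A' B B' : Type} [Fintype J] [Fintype K]
    [Fintype A'] [Fintype B'] [DecidableEq A] [DecidableEq B]
    {M : J → Matrix A' A ℂ} {N : K → Matrix B' B ℂ} (hM : IsAdmissible M) (hN : IsAdmissible N) :
    IsAdmissible fun jk : J × K => M jk.1 ⊗ₖ N jk.2 := by
  unfold IsAdmissible at *
  simp only [conjTranspose_kronecker, ← mul_kronecker_mul, Fintype.sum_prod_type]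
  rw [← one_kronecker_one, ← hM, ← hN]
  ext x y
  simp only [Matrix.sum_apply, kroneckerMap_apply, Finset.sum_mul_sum]

theorem exists_conjTranspose_mul_self {A : Type} [Fintype A] {X : Matrix A A ℂ}
    (hX : X.PosSemidef) : ∃ C : Matrix A A ℂ, X = Cᴴ * C := by
  classical
  refine ⟨CFC.sqrt X, ?_⟩
  have h := (CFC.sqrt_nonneg X).posSemidef.isHermitian
  rw [h.eq, CFC.sqrt_mul_sqrt_self X hX.nonneg]

theorem posSemidef_transmitAB {A B S Z : Type} [Finite A] [Finite B] [Finite S] [Fintype Z]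
    [DecidableEq S] {P : S → Matrix Z Z ℂ} (hP : ∀ s, (P s).PosSemidef)
    {X : Matrix ((A × Z) × B) ((A × Z) × B) ℂ} (hX : X.PosSemidef) :
    (transmitAB P X).PosSemidef := by
  classical
  cases nonempty_fintype A
  cases nonempty_fintype B
  cases nonempty_fintype S
  choose C hC using fun s => exists_conjTranspose_mul_self (hP s)
  obtain rfl : P = fun s => (C s)ᴴ * C s := funext hC
  rw [transmitAB_eq_kraus]
  exact posSemidef_sum _ fun s _ => posSemidef_sum _ fun z _ => hX.mul_mul_conjTranspose_same _

theorem trace_transmitAB {A B S Z : Type} [Fintype A] [Fintype B] [Fintype S] [Fintype Z]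
    [DecidableEq S] [DecidableEq Z] {P : S → Matrix Z Z ℂ} (hP : ∑ s, P s = 1)
    (X : Matrix ((A × Z) × B) ((A × Z) × B) ℂ) :
    (transmitAB P X).trace = X.trace := by
  have h (z w : Z) : ∑ s, P s z w = if z = w then 1 else 0 := by
    rw [← Matrix.sum_apply, hP, one_apply]
  simp only [transmitAB, LinearMap.coe_mk, AddHom.coe_mk, trace, diag_apply, of_apply,
    Fintype.sum_prod_type, if_true]
  refine Finset.sum_congr rfl fun a _ => ?_
  rw [Finset.sum_comm (γ := Z)]
  refine Finset.sum_congr rfl fun b _ => ?_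
  rw [Finset.sum_comm]
  refine Finset.sum_congr rfl fun z _ => ?_
  rw [Finset.sum_comm]
  simp only [← Finset.sum_mul, h, ite_mul, one_mul, zero_mul, Finset.sum_ite_eq, Finset.mem_univ,
    if_true]

theorem IsLOCC.posSemidef {A B A' B' : Type}
    {Φ : Matrix (A × B) (A × B) ℂ →ₗ[ℂ] Matrix (A' × B') (A' × B') ℂ} (h : IsLOCC Φ)
    {X : Matrix (A × B) (A × B) ℂ} (hX : X.PosSemidef) : (Φ X).PosSemidef := by
  induction h with
  | product M N hM hN => exact posSemidef_krausMap _ hX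
  | transmitAB P hP => exact posSemidef_transmitAB hP.1 hX
  | transmitBA P hP =>
    exact (posSemidef_transmitAB hP.1 (hX.submatrix Prod.swap)).submatrix Prod.swap
  | comp Φ Ψ _ _ h₁ h₂ => exact h₂ (h₁ hX)

theorem trace_submatrix_swap {A B : Type} [Fintype A] [Fintype B]
    (X : Matrix (A × B) (A × B) ℂ) : (X.submatrix Prod.swap Prod.swap).trace = X.trace :=
  (Equiv.prodComm B A).sum_comp fun x => X x x

theorem IsLOCC.trace_eq {A B A' B' : Type}
    {Φ : Matrix (A × B) (A × B) ℂ →ₗ[ℂ] Matrix (A' × B') (A' × B') ℂ} (h : IsLOCC Φ) :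
    ∀ [Fintype A] [Fintype B] [Fintype A'] [Fintype B'] (X : Matrix (A × B) (A × B) ℂ),
      (Φ X).trace = X.trace := by
  induction h with
  | @product _ _ _ _ _ _ jA jB jA' jB' _ _ _ _ M N hM hN =>
    intro iA iB iA' iB' X
    obtain rfl := Subsingleton.elim jA iA
    obtain rfl := Subsingleton.elim jB iB
    obtain rfl := Subsingleton.elim jA' iA'
    obtain rfl := Subsingleton.elim jB' iB'
    exact trace_krausMap (hM.kronecker hN) X
  | transmitAB P hP =>
    intro _ _ _ _ X
    convert trace_transmitAB hP.2 X
  | @transmitBA A B S Z _ _ _ _ _ _ P hP =>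
    have h (X : Matrix (A × (B × Z)) (A × (B × Z)) ℂ) :
        (Entanglement.transmitBA (A := A) (B := B) P X).trace = X.trace :=
      (trace_submatrix_swap (Entanglement.transmitAB P (X.submatrix Prod.swap Prod.swap))).trans
        ((trace_transmitAB hP.2 _).trans (trace_submatrix_swap X))
    intro _ _ _ _ X
    convert h X
  | @comp _ _ A' B' _ _ Φ Ψ h₁ h₂ ih₁ ih₂ =>
    intro _ _ _ _ X
    have := h₁.finite.2.1
    have := h₁.finite.2.2
    cases nonempty_fintype A'
    cases nonempty_fintype B'
    exact (ih₂ _).trans (ih₁ X)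

theorem IsLOCC.isState {A B A' B' : Type} [Fintype A] [Fintype B] [Fintype A'] [Fintype B']
    {Φ : Matrix (A × B) (A × B) ℂ →ₗ[ℂ] Matrix (A' × B') (A' × B') ℂ} (h : IsLOCC Φ)
    {X : Matrix (A × B) (A × B) ℂ} (hX : IsState X) : IsState (Φ X) :=
  ⟨h.posSemidef hX.1, (h.trace_eq X).trans hX.2⟩

/-- The operation `Φ ⊗ id` on `(ℂ^A ⊗ ℂ^C) ⊗ (ℂ^B ⊗ ℂ^D)`: it applies `Φ` to every block with fixed
ancilla indices. -/
def withAncilla {A B A' B' : Type} (C D : Type)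
    (Φ : Matrix (A × B) (A × B) ℂ →ₗ[ℂ] Matrix (A' × B') (A' × B') ℂ) :
    Matrix ((A × C) × (B × D)) ((A × C) × (B × D)) ℂ →ₗ[ℂ]
      Matrix ((A' × C) × (B' × D)) ((A' × C) × (B' × D)) ℂ where
  toFun X := Matrix.of fun x y =>
    Φ (Matrix.of fun u v => X ((u.1, x.1.2), (u.2, x.2.2)) ((v.1, y.1.2), (v.2, y.2.2)))
      (x.1.1, x.2.1) (y.1.1, y.2.1)
  map_add' X Y := by
    ext x y
    exact congrFun₂ (map_add Φ _ _) _ _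
  map_smul' c X := by
    ext x y
    exact congrFun₂ (map_smul Φ c _) _ _

/-- The operation that splits `ℂ^A = ℂ^C ⊗ ℂ^E` and `ℂ^B = ℂ^D ⊗ ℂ^F` along bijections of the bases
and discards (traces out) the second factor on each side. -/
def splitDiscard {A B C D E F : Type} [Fintype E] [Fintype F] (e : A ≃ C × E) (f : B ≃ D × F) :
    Matrix (A × B) (A × B) ℂ →ₗ[ℂ] Matrix (C × D) (C × D) ℂ where
  toFun X := Matrix.of fun x y => ∑ r, ∑ s,
    X (e.symm (x.1, r), f.symm (x.2, s)) (e.symm (y.1, r), f.symm (y.2, s))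
  map_add' X Y := by
    ext x y
    simp [Finset.sum_add_distrib]
  map_smul' c X := by
    ext x y
    simp [Finset.mul_sum]

/-- The Kraus operators of discarding the second factor of `ℂ^A = ℂ^C ⊗ ℂ^E`. -/
def discardKraus {A C E : Type} [DecidableEq A] (e : A ≃ C × E) (r : E) : Matrix C A ℂ :=
  Matrix.of fun c a => if a = e.symm (c, r) then 1 else 0

theorem isAdmissible_discardKraus {A C E : Type} [DecidableEq A] [Fintype E] [Fintype C]
    (e : A ≃ C × E) : IsAdmissible (discardKraus e) := by
  ext a a'
  simp only [Matrix.sum_apply, mul_apply, conjTranspose_apply, discardKraus, of_apply, one_apply]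
  rw [Finset.sum_comm, ← Fintype.sum_prod_type', Fintype.sum_eq_single (e a)]
  · simp [eq_comm]
  · intro x hx
    rw [if_neg, star_zero, zero_mul]
    rintro rfl
    simp at hx

theorem isLOCC_splitDiscard {A B C D E F : Type} [Finite A] [Finite B] [Finite C] [Finite D]
    [Fintype E] [Fintype F] (e : A ≃ C × E) (f : B ≃ D × F) : IsLOCC (splitDiscard e f) := by
  classical
  cases nonempty_fintype A
  cases nonempty_fintype B
  cases nonempty_fintype C
  cases nonempty_fintype D
  convert IsLOCC.product _ _ (isAdmissible_discardKraus e) (isAdmissible_discardKraus f)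
  ext X x y
  simp only [splitDiscard, productMap, krausMap, LinearMap.coe_mk, AddHom.coe_mk, of_apply,
    Matrix.sum_apply, mul_apply, conjTranspose_apply, kroneckerMap_apply, Fintype.sum_prod_type,
    discardKraus]
  simp [apply_ite (starRingEnd ℂ)]

theorem isAdmissible_kronecker_one {J A A' C : Type} [Fintype J] [Fintype A'] [Fintype C]
    [DecidableEq A] [DecidableEq C] {M : J → Matrix A' A ℂ} (hM : IsAdmissible M) :
    IsAdmissible fun j => M j ⊗ₖ (1 : Matrix C C ℂ) := by
  unfold IsAdmissible at *
  simp only [conjTranspose_kronecker, ← mul_kronecker_mul, conjTranspose_one, one_mul]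
  rw [← one_kronecker_one, ← hM]
  ext x y
  simp only [Matrix.sum_apply, kroneckerMap_apply, Finset.sum_mul]

theorem IsLOCC.withAncilla {A B A' B' C D : Type} [Finite C] [Finite D]
    {Φ : Matrix (A × B) (A × B) ℂ →ₗ[ℂ] Matrix (A' × B') (A' × B') ℂ} (h : IsLOCC Φ) :
    IsLOCC (withAncilla C D Φ) := by
  classical
  cases nonempty_fintype C
  cases nonempty_fintype D
  induction h with
  | product M N hM hN =>
    convert IsLOCC.product _ _ (isAdmissible_kronecker_one (C := C) hM)
      (isAdmissible_kronecker_one (C := D) hN) using 1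
    ext X ⟨⟨a, c⟩, b, d⟩ ⟨⟨a', c'⟩, b', d'⟩
    simp only [Entanglement.withAncilla, productMap, krausMap, LinearMap.coe_mk, AddHom.coe_mk,
      of_apply, Matrix.sum_apply, mul_apply, conjTranspose_apply, kroneckerMap_apply,
      Fintype.sum_prod_type, one_apply]
    simp [Finset.sum_ite_irrel, apply_ite (starRingEnd ℂ)]
  | @transmitAB A B S Z _ _ _ _ _ _ P hP =>
    have h₁ := isLOCC_splitDiscard
      (⟨fun x => (((x.1.1, x.2), x.1.2), ()), fun x => ((x.1.1.1, x.1.2), x.1.1.2),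
        fun _ => rfl, fun _ => rfl⟩ : (A × Z) × C ≃ ((A × C) × Z) × Unit)
      (Equiv.prodPUnit (B × D)).symm
    have h₂ := IsLOCC.transmitAB (A := A × C) (B := B × D) P hP
    have h₃ := isLOCC_splitDiscard (Equiv.prodPUnit (A × C)).symm
      (⟨fun x => (((x.1.1, x.2), x.1.2), ()), fun x => ((x.1.1.1, x.1.2), x.1.1.2),
        fun _ => rfl, fun _ => rfl⟩ : (B × D) × S ≃ ((B × S) × D) × Unit)
    convert (h₁.comp _ _ h₂).comp _ _ h₃ using 1
    ext X x y
    simp [Entanglement.withAncilla, splitDiscard, Entanglement.transmitAB]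
  | @transmitBA A B S Z _ _ _ _ _ _ P hP =>
    have h₁ := isLOCC_splitDiscard (Equiv.prodPUnit (A × C)).symm
      (⟨fun x => (((x.1.1, x.2), x.1.2), ()), fun x => ((x.1.1.1, x.1.2), x.1.1.2),
        fun _ => rfl, fun _ => rfl⟩ : (B × Z) × D ≃ ((B × D) × Z) × Unit)
    have h₂ := IsLOCC.transmitBA (A := A × C) (B := B × D) P hP
    have h₃ := isLOCC_splitDiscard
      (⟨fun x => (((x.1.1, x.2), x.1.2), ()), fun x => ((x.1.1.1, x.1.2), x.1.1.2),
        fun _ => rfl, fun _ => rfl⟩ : (A × C) × S ≃ ((A × S) × C) × Unit)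
      (Equiv.prodPUnit (B × D)).symm
    convert (h₁.comp _ _ h₂).comp _ _ h₃ using 1
    ext X x y
    simp [Entanglement.withAncilla, splitDiscard, Entanglement.transmitBA]
  | comp Φ Ψ _ _ h₁ h₂ => exact h₁.comp _ _ h₂

/-- The operator `X ⊗ Y`, with the two tensor factors of each party grouped together. -/
def bipartiteProd {A B C D : Type} (X : Matrix (A × B) (A × B) ℂ) (Y : Matrix (C × D) (C × D) ℂ) :
    Matrix ((A × C) × (B × D)) ((A × C) × (B × D)) ℂ :=
  Matrix.of fun x y => X (x.1.1, x.2.1) (y.1.1, y.2.1) * Y (x.1.2, x.2.2) (y.1.2, y.2.2)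

theorem withAncilla_bipartiteProd {A B A' B' C D : Type}
    (Φ : Matrix (A × B) (A × B) ℂ →ₗ[ℂ] Matrix (A' × B') (A' × B') ℂ)
    (X : Matrix (A × B) (A × B) ℂ) (Y : Matrix (C × D) (C × D) ℂ) :
    withAncilla C D Φ (bipartiteProd X Y) = bipartiteProd (Φ X) Y := by
  ext x y
  have := congrFun₂ (map_smul Φ (Y (x.1.2, x.2.2) (y.1.2, y.2.2)) X) (x.1.1, x.2.1) (y.1.1, y.2.1)
  rw [Matrix.smul_apply, smul_eq_mul, mul_comm] at this
  refine Eq.trans (congrFun₂ (congrArg Φ ?_) _ _) this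
  ext u v
  exact mul_comm _ _

/-- Local operations carry product states to product states componentwise. -/
theorem exists_isLOCC_bipartiteProd {A B A' B' C D C' D' : Type}
    {Φ : Matrix (A × B) (A × B) ℂ →ₗ[ℂ] Matrix (A' × B') (A' × B') ℂ} (hΦ : IsLOCC Φ)
    {Ψ : Matrix (C × D) (C × D) ℂ →ₗ[ℂ] Matrix (C' × D') (C' × D') ℂ} (hΨ : IsLOCC Ψ) :
    ∃ Ξ, IsLOCC Ξ ∧ ∀ X Y, Ξ (bipartiteProd X Y) = bipartiteProd (Φ X) (Ψ Y) := by
  obtain ⟨⟨_, _⟩, _, _⟩ := hΦ.finite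
  obtain ⟨⟨_, _⟩, _, _⟩ := hΨ.finite
  have h₁ := hΦ.withAncilla (C := C) (D := D)
  have h₂ := isLOCC_splitDiscard ((Equiv.prodComm A' C).trans (Equiv.prodPUnit _).symm)
    ((Equiv.prodComm B' D).trans (Equiv.prodPUnit _).symm)
  have h₃ := hΨ.withAncilla (C := A') (D := B')
  have h₄ := isLOCC_splitDiscard ((Equiv.prodComm C' A').trans (Equiv.prodPUnit _).symm)
    ((Equiv.prodComm D' B').trans (Equiv.prodPUnit _).symm)
  refine ⟨_, ((h₁.comp _ _ h₂).comp _ _ h₃).comp _ _ h₄, fun X Y => ?_⟩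
  have h : splitDiscard ((Equiv.prodComm A' C).trans (Equiv.prodPUnit _).symm)
      ((Equiv.prodComm B' D).trans (Equiv.prodPUnit _).symm) (bipartiteProd (Φ X) Y) =
      bipartiteProd Y (Φ X) := by
    ext x y
    simp [splitDiscard, bipartiteProd, mul_comm]
  simp only [LinearMap.comp_apply, withAncilla_bipartiteProd, h]
  ext x y
  simp [splitDiscard, bipartiteProd, mul_comm]

/-- Discarding the input and preparing a fixed product state. -/
theorem exists_isLOCC (A B A' B' : Type) [Finite A] [Finite B] [Finite A'] [Finite B']
    [Nonempty A'] [Nonempty B'] :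
    ∃ Φ : Matrix (A × B) (A × B) ℂ →ₗ[ℂ] Matrix (A' × B') (A' × B') ℂ, IsLOCC Φ := by
  classical
  cases nonempty_fintype A
  cases nonempty_fintype B
  cases nonempty_fintype A'
  cases nonempty_fintype B'
  have h (A A' : Type) [Fintype A] [Fintype A'] [DecidableEq A] [DecidableEq A'] (c : A') :
      IsAdmissible fun a : A => (single c a 1 : Matrix A' A ℂ) := by
    simp [IsAdmissible, conjTranspose_single, ← diagonal_one, ← sum_single_eq_diagonal]
  exact ⟨_, .product _ _ (h A A' (Classical.arbitrary A')) (h B B' (Classical.arbitrary B'))⟩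

/-! ### Fidelity with a pure state -/

theorem trace_mul_nonneg {A : Type} [Fintype A] {X Y : Matrix A A ℂ} (hX : X.PosSemidef)
    (hY : Y.PosSemidef) : 0 ≤ (X * Y).trace := by
  obtain ⟨C, rfl⟩ := exists_conjTranspose_mul_self hY
  rw [← mul_assoc, trace_mul_comm, ← mul_assoc]
  exact (hX.mul_mul_conjTranspose_same C).trace_nonneg

/-- The fidelity with a pure state: the operator under the square root has rank one. -/
theorem fidelity_vecMulVec {A : Type} [Fintype A] [DecidableEq A] {X : Matrix A A ℂ}
    (hX : X.PosSemidef) (ψ : A → ℂ) :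
    fidelity X (vecMulVec ψ (star ψ)) = √(X * vecMulVec ψ (star ψ)).trace.re := by
  set R := CFC.sqrt X
  have hR : Rᴴ = R := (CFC.sqrt_nonneg X).posSemidef.isHermitian
  have hRR : R * R = X := CFC.sqrt_mul_sqrt_self X hX.nonneg
  set w := R *ᵥ ψ with hw
  have h₁ : R * vecMulVec ψ (star ψ) * R = vecMulVec w (star w) := by
    rw [mul_vecMulVec, vecMulVec_mul, hw, star_mulVec, hR]
  have h₂ : (X * vecMulVec ψ (star ψ)).trace = w ⬝ᵥ star w := by
    rw [← hRR, mul_assoc, trace_mul_comm, h₁, trace_vecMulVec]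
  have hnn : 0 ≤ w ⬝ᵥ star w := by
    rw [← trace_vecMulVec]; exact (posSemidef_vecMulVec_self_star w).trace_nonneg
  unfold fidelity
  rw [h₁, h₂]
  obtain ⟨t, ht, hwt⟩ : ∃ t : ℝ, 0 ≤ t ∧ w ⬝ᵥ star w = (t : ℂ) :=
    ⟨_, (Complex.nonneg_iff.1 hnn).1, (Complex.ext rfl (Complex.nonneg_iff.1 hnn).2.symm)⟩
  rw [hwt, Complex.ofReal_re]
  obtain rfl | ht' := ht.eq_or_lt
  · have : w = 0 := by simpa using hwt
    simp [this]
  have hs : CFC.sqrt (vecMulVec w (star w)) = ((√t)⁻¹ : ℂ) • vecMulVec w (star w) := by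
    have h0 : (√t : ℂ) ≠ 0 := by exact_mod_cast (Real.sqrt_pos.2 ht').ne'
    refine CFC.sqrt_unique ?_ ?_
    · rw [smul_mul_smul_comm, vecMulVec_mul_vecMulVec, dotProduct_comm, hwt, vecMulVec_smul,
        smul_smul,
        ← mul_inv, ← Complex.ofReal_mul, Real.mul_self_sqrt ht, inv_mul_cancel₀, one_smul]
      exact_mod_cast ht'.ne'
    · refine (PosSemidef.smul (posSemidef_vecMulVec_self_star w) ?_).nonneg
      rw [← Complex.ofReal_inv]
      exact_mod_cast inv_nonneg.2 (Real.sqrt_nonneg t)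
  rw [hs, trace_smul, trace_vecMulVec, hwt, smul_eq_mul, ← Complex.ofReal_inv,
    ← Complex.ofReal_mul, Complex.ofReal_re, inv_mul_eq_div, Real.div_sqrt]

/-! ### Tensor products of states -/

/-- The tensor product of a family of bipartite operators, with Alice's and Bob's factors grouped
together. -/
def tensorProd {ι A B : Type} [Fintype ι] (ρ : ι → Matrix (A × B) (A × B) ℂ) :
    Matrix ((ι → A) × (ι → B)) ((ι → A) × (ι → B)) ℂ :=
  Matrix.of fun x y => ∏ i, ρ i (x.1 i, x.2 i) (y.1 i, y.2 i)

theorem tensorPower_eq_tensorProd {A B : Type} (ρ : Matrix (A × B) (A × B) ℂ) (n : ℕ) :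
    tensorPower ρ n = tensorProd fun _ : Fin n => ρ := rfl

theorem sum_prod_pair {ι A B : Type} [Fintype ι] [DecidableEq ι] [Fintype A] [Fintype B]
    (f : ι → A × B → ℂ) :
    ∑ x : (ι → A) × (ι → B), ∏ i, f i (x.1 i, x.2 i) = ∏ i, ∑ u, f i u := by
  rw [Finset.prod_univ_sum, Fintype.piFinset_univ,
    ← (Equiv.arrowProdEquivProdArrow ι (fun _ => A) (fun _ => B)).sum_comp]
  rfl

theorem tensorProd_mul {ι A B : Type} [Fintype ι] [DecidableEq ι] [Fintype A] [Fintype B]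
    (ρ σ : ι → Matrix (A × B) (A × B) ℂ) :
    tensorProd ρ * tensorProd σ = tensorProd fun i => ρ i * σ i := by
  ext x y
  simp only [mul_apply, tensorProd, of_apply, ← Finset.prod_mul_distrib]
  exact sum_prod_pair fun i u => ρ i (x.1 i, x.2 i) u * σ i u (y.1 i, y.2 i)

theorem conjTranspose_tensorProd {ι A B : Type} [Fintype ι] (ρ : ι → Matrix (A × B) (A × B) ℂ) :
    (tensorProd ρ)ᴴ = tensorProd fun i => (ρ i)ᴴ := by
  ext x y
  simp [tensorProd]

theorem isState_tensorProd {ι A B : Type} [Fintype ι] [DecidableEq ι] [Fintype A] [Fintype B]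
    {ρ : ι → Matrix (A × B) (A × B) ℂ} (h : ∀ i, IsState (ρ i)) : IsState (tensorProd ρ) := by
  constructor
  · choose C hC using fun i => exists_conjTranspose_mul_self (h i).1
    obtain rfl : ρ = fun i => (C i)ᴴ * C i := funext hC
    rw [← tensorProd_mul, ← conjTranspose_tensorProd]
    exact posSemidef_conjTranspose_mul_self _
  · have := sum_prod_pair fun i u => ρ i u u
    exact this.trans (Finset.prod_eq_one fun i _ => (h i).2)

theorem posSemidef_bipartiteProd {A B C D : Type} [Finite A] [Finite B] [Finite C] [Finite D]
    {X : Matrix (A × B) (A × B) ℂ} {Y : Matrix (C × D) (C × D) ℂ} (hX : X.PosSemidef)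
    (hY : Y.PosSemidef) : (bipartiteProd X Y).PosSemidef := by
  cases nonempty_fintype A
  cases nonempty_fintype B
  cases nonempty_fintype C
  cases nonempty_fintype D
  exact (hX.kronecker hY).submatrix fun x : (A × C) × (B × D) => ((x.1.1, x.2.1), (x.1.2, x.2.2))

theorem trace_bipartiteProd_mul {A B C D : Type} [Fintype A] [Fintype B] [Fintype C] [Fintype D]
    (X X' : Matrix (A × B) (A × B) ℂ) (Y Y' : Matrix (C × D) (C × D) ℂ) :
    (bipartiteProd X Y * bipartiteProd X' Y').trace = (X * X').trace * (Y * Y').trace := by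
  rw [← trace_kronecker, mul_kronecker_mul]
  have (Z W : Matrix ((A × B) × C × D) ((A × B) × C × D) ℂ) :
      (Z.submatrix (Equiv.prodProdProdComm A C B D) (Equiv.prodProdProdComm A C B D) *
        W.submatrix (Equiv.prodProdProdComm A C B D) (Equiv.prodProdProdComm A C B D)).trace =
        (Z * W).trace := by
    rw [submatrix_mul_equiv]
    exact (Equiv.prodProdProdComm A C B D).sum_comp fun x => (Z * W) x x
  exact this (X ⊗ₖ Y) (X' ⊗ₖ Y')

/-! ### Overlap with maximally entangled pairs -/

theorem tau_apply (x y : Fin 2 × Fin 2) :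
    tau x y = if x.1 = x.2 ∧ y.1 = y.2 then 1 / 2 else 0 := by
  obtain ⟨a, b⟩ := x
  obtain ⟨a', b'⟩ := y
  fin_cases a <;> fin_cases b <;> fin_cases a' <;> fin_cases b' <;>
    simp [tau]

theorem tensorPower_tau_apply (k : ℕ) (x y : (Fin k → Fin 2) × (Fin k → Fin 2)) :
    tensorPower tau k x y = if x.1 = x.2 ∧ y.1 = y.2 then (1 / 2) ^ k else 0 := by
  simp only [tensorPower, of_apply, tau_apply]
  rw [Finset.prod_ite_zero]
  simp [funext_iff, forall_and]

/-- The vector `2^(-k/2) ∑ x, |x, x⟩` of `k` maximally entangled pairs. -/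
noncomputable def pairsVec (k : ℕ) (x : (Fin k → Fin 2) × (Fin k → Fin 2)) : ℂ :=
  if x.1 = x.2 then ((√((1 / 2) ^ k) : ℝ) : ℂ) else 0

theorem tensorPower_tau_eq (k : ℕ) :
    tensorPower tau k = vecMulVec (pairsVec k) (star (pairsVec k)) := by
  ext x y
  rw [tensorPower_tau_apply, vecMulVec_apply]
  have : ((√((1 / 2) ^ k) : ℝ) : ℂ) * ((√((1 / 2) ^ k) : ℝ) : ℂ) = (1 / 2) ^ k := by
    rw [← Complex.ofReal_mul, Real.mul_self_sqrt (by positivity)]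
    push_cast; rfl
  by_cases h : x.1 = x.2 <;> by_cases h' : y.1 = y.2 <;>
    simp only [pairsVec, Pi.star_apply, h, h', if_true, if_false, and_true, and_false, star_zero,
      mul_zero, zero_mul]
  rw [Complex.star_def, Complex.conj_ofReal, this]

theorem isState_tau : IsState tau := by
  have h : tau = (1 / 2 : ℂ) • vecMulVec (fun x : Fin 2 × Fin 2 => if x.1 = x.2 then (1 : ℂ) else 0)
      (star fun x : Fin 2 × Fin 2 => if x.1 = x.2 then (1 : ℂ) else 0) := by
    ext x y
    by_cases hx : x.1 = x.2 <;> by_cases hy : y.1 = y.2 <;>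
      simp [tau_apply, vecMulVec_apply, hx, hy]
  constructor
  · rw [h]
    exact (posSemidef_vecMulVec_self_star _).smul (by simp)
  · simp [trace, tau_apply, Fintype.sum_prod_type]

theorem posSemidef_one_sub_tensorPower_tau (k : ℕ) : (1 - tensorPower tau k).PosSemidef := by
  have hs : IsState (tensorPower tau k) := isState_tensorProd fun _ => isState_tau
  have hP : tensorPower tau k * tensorPower tau k = tensorPower tau k := by
    have ht := hs.2
    rw [tensorPower_tau_eq, trace_vecMulVec] at ht
    rw [tensorPower_tau_eq, vecMulVec_mul_vecMulVec, dotProduct_comm, ht, one_smul]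
  have : 1 - tensorPower tau k = (1 - tensorPower tau k)ᴴ * (1 - tensorPower tau k) := by
    rw [conjTranspose_sub, conjTranspose_one, hs.1.isHermitian.eq, sub_mul, mul_sub, mul_sub, hP]
    simp
  rw [this]
  exact posSemidef_conjTranspose_mul_self _

/-- The overlap `Tr(X τ^{⊗k})`, which is the square of the fidelity with `τ^{⊗k}` but linear in
`X`. -/
noncomputable def overlap {k : ℕ}
    (X : Matrix ((Fin k → Fin 2) × (Fin k → Fin 2)) ((Fin k → Fin 2) × (Fin k → Fin 2)) ℂ) : ℝ :=
  (X * tensorPower tau k).trace.re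

theorem fidelity_eq_sqrt_overlap {k : ℕ}
    {X : Matrix ((Fin k → Fin 2) × (Fin k → Fin 2)) ((Fin k → Fin 2) × (Fin k → Fin 2)) ℂ}
    (hX : X.PosSemidef) : fidelity X (tensorPower tau k) = √(overlap X) := by
  rw [overlap, tensorPower_tau_eq, fidelity_vecMulVec hX]

theorem trace_mul_tensorPower_tau {k : ℕ}
    {X : Matrix ((Fin k → Fin 2) × (Fin k → Fin 2)) ((Fin k → Fin 2) × (Fin k → Fin 2)) ℂ}
    (hX : X.PosSemidef) : (X * tensorPower tau k).trace = overlap X := by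
  have h := trace_mul_nonneg hX (isState_tensorProd fun _ : Fin k => isState_tau).1
  exact Complex.ext rfl (Complex.nonneg_iff.1 h).2.symm

theorem overlap_nonneg {k : ℕ}
    {X : Matrix ((Fin k → Fin 2) × (Fin k → Fin 2)) ((Fin k → Fin 2) × (Fin k → Fin 2)) ℂ}
    (hX : X.PosSemidef) : 0 ≤ overlap X :=
  (Complex.nonneg_iff.1
    (trace_mul_nonneg hX (isState_tensorProd fun _ : Fin k => isState_tau).1)).1

theorem overlap_le_one {k : ℕ}
    {X : Matrix ((Fin k → Fin 2) × (Fin k → Fin 2)) ((Fin k → Fin 2) × (Fin k → Fin 2)) ℂ}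
    (hX : IsState X) : overlap X ≤ 1 := by
  have h := (Complex.nonneg_iff.1
    (trace_mul_nonneg hX.1 (posSemidef_one_sub_tensorPower_tau k))).1
  rw [mul_sub, mul_one, trace_sub, hX.2, Complex.sub_re, Complex.one_re] at h
  exact sub_nonneg.1 h

/-- Fidelities tend to one if and only if overlaps do. -/
theorem isDistillationRate_iff {A B : Type} [Fintype A] [Fintype B]
    {ρ : Matrix (A × B) (A × B) ℂ} (hρ : IsState ρ) (α : ℝ≥0) :
    IsDistillationRate ρ α ↔
      ∃ Φ : ∀ n : ℕ, Matrix ((Fin n → A) × (Fin n → B)) ((Fin n → A) × (Fin n → B)) ℂ →ₗ[ℂ]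
        Matrix ((Fin ⌊α * n⌋₊ → Fin 2) × (Fin ⌊α * n⌋₊ → Fin 2))
          ((Fin ⌊α * n⌋₊ → Fin 2) × (Fin ⌊α * n⌋₊ → Fin 2)) ℂ,
      (∀ n, IsLOCC (Φ n)) ∧
      Filter.Tendsto (fun n => overlap (Φ n (tensorPower ρ n))) Filter.atTop (nhds 1) := by
  refine exists_congr fun Φ => and_congr_right fun hΦ => ?_
  have hX (n : ℕ) : (Φ n (tensorPower ρ n)).PosSemidef :=
    (hΦ n).posSemidef (isState_tensorProd fun _ => hρ).1
  simp only [fidelity_eq_sqrt_overlap (hX _)]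
  constructor <;> intro h
  · simpa [Real.sq_sqrt (overlap_nonneg (hX _))] using h.pow 2
  · simpa using h.sqrt

/-- Discarding is adjoint to tensoring with the identity. -/
theorem trace_splitDiscard_mul {A B C D E F : Type} [Fintype A] [Fintype B] [Fintype C] [Fintype D]
    [Fintype E] [Fintype F] [DecidableEq E] [DecidableEq F] (e : A ≃ C × E) (f : B ≃ D × F)
    (Z : Matrix (A × B) (A × B) ℂ) (W : Matrix (C × D) (C × D) ℂ) :
    (splitDiscard e f Z * W).trace =
      (Z * (bipartiteProd W (1 : Matrix (E × F) (E × F) ℂ)).submatrix (e.prodCongr f)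
        (e.prodCongr f)).trace := by
  set G := e.prodCongr f with hG
  set V := bipartiteProd W (1 : Matrix (E × F) (E × F) ℂ) with hV
  have h : (Z * V.submatrix G G).trace = (Z.submatrix G.symm G.symm * V).trace := by
    have hZ : Z = (Z.submatrix G.symm G.symm).submatrix G G := by simp
    conv_lhs => rw [hZ, submatrix_mul_equiv]
    exact G.sum_comp fun x => (Z.submatrix G.symm G.symm * V) x x
  rw [h]
  simp only [trace, diag_apply, mul_apply, splitDiscard, LinearMap.coe_mk, AddHom.coe_mk,
    of_apply, hV, bipartiteProd, Fintype.sum_prod_type, one_apply, submatrix_apply]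
  refine Finset.sum_congr rfl fun c _ => ?_
  rw [Finset.sum_comm (γ := E)]
  refine Finset.sum_congr rfl fun d _ => ?_
  simp only [Prod.mk.injEq, ite_and, mul_ite, mul_one, mul_zero, Finset.sum_ite_eq',
    Finset.mem_univ, if_true, Finset.sum_ite_irrel, Finset.sum_const_zero]
  simp only [Finset.sum_mul, ← Fintype.sum_prod_type']
  exact Fintype.sum_equiv ⟨fun x => (x.2.2.1, x.2.2.2, x.1, x.2.1),
    fun x => (x.2.2.1, x.2.2.2, x.1, x.2.1), fun _ => rfl, fun _ => rfl⟩ _ _ fun _ => rfl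

/-- Discarding surplus pairs does not lower the overlap. -/
theorem exists_isLOCC_discard_pairs {k₁ k₂ k : ℕ} (hk : k ≤ k₁ + k₂) :
    ∃ Φ : Matrix (((Fin k₁ → Fin 2) × (Fin k₂ → Fin 2)) × ((Fin k₁ → Fin 2) × (Fin k₂ → Fin 2)))
        (((Fin k₁ → Fin 2) × (Fin k₂ → Fin 2)) × ((Fin k₁ → Fin 2) × (Fin k₂ → Fin 2))) ℂ →ₗ[ℂ]
        Matrix ((Fin k → Fin 2) × (Fin k → Fin 2)) ((Fin k → Fin 2) × (Fin k → Fin 2)) ℂ,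
      IsLOCC Φ ∧ ∀ X Y, X.PosSemidef → Y.PosSemidef →
        overlap X * overlap Y ≤ overlap (Φ (bipartiteProd X Y)) := by
  obtain ⟨r, hr⟩ := Nat.exists_eq_add_of_le hk
  let s : Fin k₁ ⊕ Fin k₂ ≃ Fin k ⊕ Fin r :=
    finSumFinEquiv.trans ((finCongr hr).trans finSumFinEquiv.symm)
  let e : (Fin k₁ → Fin 2) × (Fin k₂ → Fin 2) ≃ (Fin k → Fin 2) × (Fin r → Fin 2) :=
    (Equiv.sumArrowEquivProdArrow _ _ _).symm.trans
      ((Equiv.arrowCongr s (Equiv.refl _)).trans (Equiv.sumArrowEquivProdArrow _ _ _))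
  let E := Equiv.prodCongr e e
  refine ⟨_, isLOCC_splitDiscard e e, fun X Y hX hY => ?_⟩
  -- The surplus pairs are replaced by the identity, which dominates them.
  have h₂ : bipartiteProd (tensorPower tau k₁) (tensorPower tau k₂) =
      (bipartiteProd (tensorPower tau k) (tensorPower tau r)).submatrix E E := by
    ext ⟨a, b⟩ ⟨a', b'⟩
    have hab (a b) : (e a).1 = (e b).1 ∧ (e a).2 = (e b).2 ↔ a.1 = b.1 ∧ a.2 = b.2 := by
      rw [← Prod.ext_iff, ← Prod.ext_iff, e.apply_eq_iff_eq]
    have h := hab a b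
    have h' := hab a' b'
    simp only [bipartiteProd, of_apply, tensorPower_tau_apply, submatrix_apply, E,
      Equiv.prodCongr_apply, Prod.map, ite_mul, mul_ite, zero_mul, mul_zero, ← ite_and, ← pow_add,
      hr]
    congr 1
    rw [eq_iff_iff]
    tauto
  have h₃ := trace_mul_nonneg (posSemidef_bipartiteProd hX hY)
    ((posSemidef_bipartiteProd (isState_tensorProd fun _ : Fin k => isState_tau).1
      (posSemidef_one_sub_tensorPower_tau r)).submatrix E)
  have h₄ : (bipartiteProd (tensorProd fun _ : Fin k => tau) (1 - tensorPower tau r)).submatrix E E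
      = (bipartiteProd (tensorPower tau k) 1).submatrix E E -
        bipartiteProd (tensorPower tau k₁) (tensorPower tau k₂) := by
    rw [h₂]
    ext x y
    simp [bipartiteProd, mul_sub, tensorPower_eq_tensorProd]
  rw [h₄, mul_sub, trace_sub, trace_bipartiteProd_mul, trace_mul_tensorPower_tau hX,
    trace_mul_tensorPower_tau hY, ← Complex.ofReal_mul,
    ← trace_splitDiscard_mul] at h₃
  have := (Complex.nonneg_iff.1 h₃).1
  rw [Complex.sub_re, Complex.ofReal_re] at this
  exact sub_nonneg.1 this

/-! ### Sorting copies by a local measurement -/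

/-- A labelling of `n` copies by two values can be undone by a permutation that lists `m₁` copies
with label `true`, then `m₂` copies with label `false`, then the rest, if there are enough copies
of both sorts. -/
theorem exists_sorting_equiv {n m₁ m₂ r : ℕ} (hn : n = m₁ + m₂ + r) (g : Fin n → Bool) :
    ∃ e : (Fin m₁ ⊕ Fin m₂) ⊕ Fin r ≃ Fin n,
      m₁ ≤ Fintype.card {i // g i = true} → m₂ ≤ Fintype.card {i // g i = false} →
        (∀ i, g (e (.inl (.inl i))) = true) ∧ ∀ i, g (e (.inl (.inr i))) = false := by
  classical
  by_cases h : m₁ ≤ Fintype.card {i // g i = true} ∧ m₂ ≤ Fintype.card {i // g i = false}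
  · obtain ⟨f₁⟩ := Function.Embedding.nonempty_of_card_le (α := Fin m₁)
      (β := {i // g i = true}) (by simpa using h.1)
    obtain ⟨f₂⟩ := Function.Embedding.nonempty_of_card_le (α := Fin m₂)
      (β := {i // g i = false}) (by simpa using h.2)
    let f : Fin m₁ ⊕ Fin m₂ → Fin n := Sum.elim (fun i => f₁ i) fun i => f₂ i
    have hf : Function.Injective f := by
      refine (Subtype.val_injective.comp f₁.injective).sumElim
        (Subtype.val_injective.comp f₂.injective) fun i j hij => ?_
      have := (f₁ i).2
      simp only [Function.comp_apply] at hij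
      rw [hij, (f₂ j).2] at this
      cases this
    have hc : Fintype.card (Fin r) = Fintype.card ((Set.range f)ᶜ : Set (Fin n)) := by
      rw [Fintype.card_compl_set, ← Fintype.card_congr (Equiv.ofInjective f hf)]
      simp [hn]
    refine ⟨((Equiv.ofInjective f hf).sumCongr (Fintype.equivOfCardEq hc)).trans
      (Equiv.Set.sumCompl _), fun _ _ => ⟨fun i => (f₁ i).2, fun i => (f₂ i).2⟩⟩
  · exact ⟨Fintype.equivOfCardEq (by simp [hn]), fun h₁ h₂ => (h ⟨h₁, h₂⟩).elim⟩

/-- The isometry `∑ f, (⊗ᵢ Q (f i)) ⊗ |f⟩` which performs the measurement with Kraus operators `Q`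
on every tensor factor and records the outcomes. -/
def recordIsometry {n : ℕ} {A : Type} (Q : Bool → Matrix A A ℂ) :
    Matrix ((Fin n → A) × (Fin n → Bool)) (Fin n → A) ℂ :=
  Matrix.of fun x u => ∏ i, Q (x.2 i) (x.1 i) (u i)

theorem isAdmissible_recordIsometry {n : ℕ} {A : Type} [Fintype A] [DecidableEq A]
    {Q : Bool → Matrix A A ℂ} (hQ : IsAdmissible Q) :
    IsAdmissible fun _ : Unit => recordIsometry (n := n) Q := by
  unfold IsAdmissible at *
  ext u v
  have h (i : Fin n) : ∑ x : A × Bool, star (Q x.2 x.1 (u i)) * Q x.2 x.1 (v i) =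
      (1 : Matrix A A ℂ) (u i) (v i) := by
    rw [← hQ, Matrix.sum_apply, Fintype.sum_prod_type, Finset.sum_comm]
    rfl
  simp only [Finset.univ_unique, Finset.sum_singleton, mul_apply, conjTranspose_apply,
    recordIsometry, of_apply, star_prod, ← Finset.prod_mul_distrib]
  rw [sum_prod_pair fun i (x : A × Bool) => star (Q x.2 x.1 (u i)) * Q x.2 x.1 (v i)]
  simp only [h, one_apply, Finset.prod_ite_zero, Finset.prod_const_one, funext_iff,
    Finset.mem_univ, true_implies]

/-- Recording the outcomes of a nondisturbing measurement on a product of states with labels `g`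
leaves the product unchanged and writes `g` into the register. -/
theorem productMap_recordIsometry_apply {n : ℕ} {A B : Type} [Fintype A] [Fintype B]
    [DecidableEq A] [DecidableEq B] {Q : Bool → Matrix A A ℂ} {ρ : Bool → Matrix (A × B) (A × B) ℂ}
    (hQ : ∀ b c, (Q b ⊗ₖ (1 : Matrix B B ℂ)) * ρ c = if b = c then ρ c else 0)
    (hρ : ∀ b, (ρ b).IsHermitian) (g : Fin n → Bool)
    (x y : ((Fin n → A) × (Fin n → Bool)) × (Fin n → B)) :
    productMap (fun _ : Unit => recordIsometry (n := n) Q)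
        (fun _ : Unit => (1 : Matrix (Fin n → B) (Fin n → B) ℂ)) (tensorProd fun i => ρ (g i)) x y =
      if x.1.2 = g ∧ y.1.2 = g then
        tensorProd (fun i => ρ (g i)) (x.1.1, x.2) (y.1.1, y.2) else 0 := by
  have hK (x : ((Fin n → A) × (Fin n → Bool)) × (Fin n → B)) (u : (Fin n → A) × (Fin n → B)) :
      (recordIsometry Q ⊗ₖ (1 : Matrix (Fin n → B) (Fin n → B) ℂ)) x u =
        tensorProd (fun i => Q (x.1.2 i) ⊗ₖ (1 : Matrix B B ℂ)) (x.1.1, x.2) u := by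
    simp only [kroneckerMap_apply, recordIsometry, of_apply, tensorProd, one_apply,
      Finset.prod_mul_distrib, Finset.prod_ite_zero, Finset.prod_const_one, funext_iff,
      Finset.mem_univ, true_implies]
  have hQ' (b c) : ρ c * (Q b ⊗ₖ (1 : Matrix B B ℂ))ᴴ = if b = c then ρ c else 0 := by
    have := congrArg conjTranspose (hQ b c)
    rwa [conjTranspose_mul, (hρ c).eq, apply_ite conjTranspose, (hρ c).eq,
      conjTranspose_zero] at this
  have h : productMap (fun _ : Unit => recordIsometry (n := n) Q)
        (fun _ : Unit => (1 : Matrix (Fin n → B) (Fin n → B) ℂ)) (tensorProd fun i => ρ (g i)) x y =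
      (tensorProd (fun i => Q (x.1.2 i) ⊗ₖ (1 : Matrix B B ℂ)) * tensorProd (fun i => ρ (g i)) *
        (tensorProd fun i => Q (y.1.2 i) ⊗ₖ (1 : Matrix B B ℂ))ᴴ) (x.1.1, x.2) (y.1.1, y.2) := by
    simp only [productMap, krausMap, LinearMap.coe_mk, AddHom.coe_mk, Matrix.sum_apply,
      mul_apply, conjTranspose_apply, hK]
    simp
  rw [h, conjTranspose_tensorProd, tensorProd_mul, tensorProd_mul]
  simp only [hQ]
  split_ifs with hg
  · simp [hg.1, hg.2, hQ']
  · rw [tensorProd, of_apply, Finset.prod_eq_zero_iff]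
    by_contra! hc
    refine hg ⟨funext fun i => ?_, funext fun i => ?_⟩ <;> by_contra hi <;> apply hc i
      (Finset.mem_univ i)
    · simp [hi]
    · split_ifs <;> simp [hi, hQ']

/-- The tuple `x : ι → A`, listed along `e` and cut into three pieces. -/
def splitEquiv {ι κ₁ κ₂ κ₃ : Type} (A : Type) (e : (κ₁ ⊕ κ₂) ⊕ κ₃ ≃ ι) :
    (ι → A) ≃ ((κ₁ → A) × (κ₂ → A)) × (κ₃ → A) :=
  ((Equiv.arrowCongr e (Equiv.refl A)).symm.trans (Equiv.sumArrowEquivProdArrow _ _ _)).trans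
    ((Equiv.sumArrowEquivProdArrow _ _ _).prodCongr (Equiv.refl _))

theorem splitEquiv_symm_apply {ι κ₁ κ₂ κ₃ A : Type} (e : (κ₁ ⊕ κ₂) ⊕ κ₃ ≃ ι)
    (x : ((κ₁ → A) × (κ₂ → A)) × (κ₃ → A)) (j : (κ₁ ⊕ κ₂) ⊕ κ₃) :
    (splitEquiv A e).symm x (e j) = Sum.elim (Sum.elim x.1.1 x.1.2) x.2 j := by
  obtain ⟨x, rfl⟩ := (splitEquiv A e).surjective x
  rw [Equiv.symm_apply_apply]
  obtain (j | j) | j := j <;> rfl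

/-- Splitting off and discarding surplus factors of a product state. -/
theorem sum_tensorProd_split {ι κ₁ κ₂ κ₃ A B : Type} [Fintype ι] [Fintype κ₁] [Fintype κ₂]
    [Fintype κ₃] [Fintype A] [Fintype B] [DecidableEq κ₃] (e : (κ₁ ⊕ κ₂) ⊕ κ₃ ≃ ι)
    {ρ : ι → Matrix (A × B) (A × B) ℂ} (hρ : ∀ i, (ρ i).trace = 1)
    (x y : ((κ₁ → A) × (κ₂ → A)) × ((κ₁ → B) × (κ₂ → B))) :
    ∑ r, ∑ s, tensorProd ρ ((splitEquiv A e).symm (x.1, r), (splitEquiv B e).symm (x.2, s))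
        ((splitEquiv A e).symm (y.1, r), (splitEquiv B e).symm (y.2, s)) =
      bipartiteProd (tensorProd fun i => ρ (e (.inl (.inl i))))
        (tensorProd fun i => ρ (e (.inl (.inr i)))) x y := by
  simp only [tensorProd, of_apply, ← e.prod_comp, Fintype.prod_sum_type, splitEquiv_symm_apply,
    Sum.elim_inl, Sum.elim_inr, bipartiteProd, ← Finset.mul_sum]
  have h : ∏ i, ∑ u, ρ (e (.inr i)) u u = 1 := Finset.prod_eq_one fun i _ => hρ _
  rw [← Fintype.sum_prod_type', sum_prod_pair fun i u => ρ (e (.inr i)) u u, h, mul_one]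

/-- Alice measures every copy and records the outcomes in a register, which is then sent to Bob;
both parties permute their factors according to the register. -/
theorem exists_isLOCC_sort {n m₁ m₂ r : ℕ} {A B : Type} [Fintype A] [Fintype B] [DecidableEq A]
    [DecidableEq B] (hn : n = m₁ + m₂ + r) {Q : Bool → Matrix A A ℂ}
    {ρ : Bool → Matrix (A × B) (A × B) ℂ} (hQ : IsAdmissible Q)
    (hQρ : ∀ b c, (Q b ⊗ₖ (1 : Matrix B B ℂ)) * ρ c = if b = c then ρ c else 0)
    (hρ : ∀ b, IsState (ρ b)) :
    ∃ Ξ : Matrix ((Fin n → A) × (Fin n → B)) ((Fin n → A) × (Fin n → B)) ℂ →ₗ[ℂ]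
        Matrix (((Fin m₁ → A) × (Fin m₂ → A)) × ((Fin m₁ → B) × (Fin m₂ → B)))
          (((Fin m₁ → A) × (Fin m₂ → A)) × ((Fin m₁ → B) × (Fin m₂ → B))) ℂ,
      IsLOCC Ξ ∧ ∀ g : Fin n → Bool, m₁ ≤ Fintype.card {i // g i = true} →
        m₂ ≤ Fintype.card {i // g i = false} → Ξ (tensorProd fun i => ρ (g i)) =
          bipartiteProd (tensorPower (ρ true) m₁) (tensorPower (ρ false) m₂) := by
  choose e he using exists_sorting_equiv (m₁ := m₁) (m₂ := m₂) (r := r) hn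
  -- Both parties use the permutation `e f` controlled by the content `f` of the register. Alice
  -- keeps the register, to be sent; Bob discards it in the end.
  let eA : (Fin n → A) × (Fin n → Bool) ≃
      (((Fin m₁ → A) × (Fin m₂ → A)) × (Fin n → Bool)) × (Fin r → A) :=
    { toFun x := ((((splitEquiv A (e x.2)) x.1).1, x.2), ((splitEquiv A (e x.2)) x.1).2)
      invFun x := ((splitEquiv A (e x.1.2)).symm (x.1.1, x.2), x.1.2)
      left_inv x := by simp
      right_inv x := by simp }
  let eB : (Fin n → B) × (Fin n → Bool) ≃
      ((Fin m₁ → B) × (Fin m₂ → B)) × ((Fin r → B) × (Fin n → Bool)) :=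
    { toFun x := (((splitEquiv B (e x.2)) x.1).1, (((splitEquiv B (e x.2)) x.1).2, x.2))
      invFun x := ((splitEquiv B (e x.2.2)).symm (x.1, x.2.1), x.2.2)
      left_inv x := by simp
      right_inv x := by simp }
  have hP : IsMeasurement fun f : Fin n → Bool => (single f f 1 : Matrix _ _ ℂ) := by
    constructor
    · intro f
      have := posSemidef_self_mul_conjTranspose (single f f 1 : Matrix _ (Fin n → Bool) ℂ)
      simpa [conjTranspose_single] using this
    · simp [← diagonal_one, ← sum_single_eq_diagonal]
  have h₁ := IsLOCC.product _ (fun _ : Unit => (1 : Matrix (Fin n → B) (Fin n → B) ℂ))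
    (isAdmissible_recordIsometry (n := n) hQ) (by simp [IsAdmissible])
  have h₂ := isLOCC_splitDiscard eA (Equiv.prodPUnit (Fin n → B)).symm
  have h₃ := IsLOCC.transmitAB (A := (Fin m₁ → A) × (Fin m₂ → A)) (B := Fin n → B) _ hP
  have h₄ := isLOCC_splitDiscard (Equiv.prodPUnit ((Fin m₁ → A) × (Fin m₂ → A))).symm eB
  refine ⟨_, ((h₁.comp _ _ h₂).comp _ _ h₃).comp _ _ h₄, fun g hg₁ hg₂ => ?_⟩
  obtain ⟨ht, hf⟩ := he g hg₁ hg₂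
  have key := sum_tensorProd_split (e g) (ρ := fun i => ρ (g i)) fun i => (hρ _).2
  simp only [ht, hf, ← tensorPower_eq_tensorProd] at key
  ext x y
  rw [← key]
  simp only [LinearMap.comp_apply, splitDiscard, LinearMap.coe_mk, AddHom.coe_mk, of_apply,
    transmitAB, productMap_recordIsometry_apply hQρ (fun b => (hρ b).1.isHermitian),
    single_apply, eA, eB,
    Equiv.coe_fn_symm_mk, Fintype.sum_prod_type]
  rw [Finset.sum_comm (γ := Fin r → A)]
  simp [ite_and]

/-! ### Local orthogonality -/

theorem mul_eq_zero_of_trace_mul_eq_zero {A : Type} [Fintype A] {X Y : Matrix A A ℂ}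
    (hX : X.PosSemidef) (hY : Y.PosSemidef) (h : (X * Y).trace = 0) : X * Y = 0 := by
  obtain ⟨C, rfl⟩ := exists_conjTranspose_mul_self hX
  obtain ⟨D, rfl⟩ := exists_conjTranspose_mul_self hY
  have h0 : (D * Cᴴ * (D * Cᴴ)ᴴ).trace = 0 := by
    rw [← h, conjTranspose_mul, conjTranspose_conjTranspose, trace_mul_comm (Cᴴ * C),
      trace_mul_comm (D * Cᴴ)]
    simp only [mul_assoc]
    rw [trace_mul_comm]
    simp only [mul_assoc]
  rw [trace_mul_conjTranspose_self_eq_zero_iff] at h0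
  have h1 : C * Dᴴ = 0 := by simpa using congrArg conjTranspose h0
  rw [mul_assoc, ← mul_assoc C, h1, zero_mul, mul_zero]

/-- The orthogonal projection onto the support of a Hermitian matrix: it fixes the matrix, and it
annihilates every matrix that the given one annihilates. -/
theorem exists_support_projection {A : Type} [Fintype A] [DecidableEq A] {X : Matrix A A ℂ}
    (hX : X.IsHermitian) :
    ∃ P : Matrix A A ℂ, Pᴴ = P ∧ P * P = P ∧ P * X = X ∧
      ∀ Y : Matrix A A ℂ, X * Y = 0 → P * Y = 0 := by
  have hc (f : ℝ → ℝ) : ContinuousOn f (spectrum ℝ X) :=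
    X.finite_real_spectrum.continuousOn f
  have hsa : IsSelfAdjoint X := hX
  refine ⟨cfc (fun x : ℝ => x⁻¹ * x) X, ?_, ?_, ?_, fun Y hY => ?_⟩
  · exact cfc_predicate (R := ℝ) _ X
  · rw [← cfc_mul _ _ X (hc _) (hc _)]
    congr 1
    ext x
    by_cases hx : x = 0 <;> simp [hx]
  · calc _ = cfc (fun x : ℝ => x⁻¹ * x) X * cfc (fun x : ℝ => x) X := by rw [cfc_id' ℝ X]
      _ = cfc (fun x : ℝ => x⁻¹ * x * x) X := (cfc_mul _ _ X (hc _) (hc _)).symm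
      _ = cfc (fun x : ℝ => x) X := by
        congr 1
        ext x
        by_cases hx : x = 0 <;> simp [hx]
      _ = X := cfc_id' ℝ X
  · rw [cfc_mul _ _ X (hc _) (hc _), cfc_id' ℝ X, mul_assoc, hY, mul_zero]

theorem posSemidef_reducedA {A B : Type} [Finite A] [Fintype B] {ρ : Matrix (A × B) (A × B) ℂ}
    (hρ : ρ.PosSemidef) : (reducedA ρ).PosSemidef := by
  have : reducedA ρ = ∑ b, ρ.submatrix (fun a => (a, b)) fun a => (a, b) := by
    ext a a'
    simp [reducedA, Matrix.sum_apply]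
  rw [this]
  exact posSemidef_sum _ fun b _ => hρ.submatrix _

/-- A local operator that annihilates the reduced state annihilates the state. -/
theorem kronecker_one_mul_eq_zero {A B : Type} [Fintype A] [Fintype B] [DecidableEq B]
    {ρ : Matrix (A × B) (A × B) ℂ} (hρ : ρ.PosSemidef) {Q : Matrix A A ℂ}
    (hQ : Q * reducedA ρ = 0) : (Q ⊗ₖ (1 : Matrix B B ℂ)) * ρ = 0 := by
  obtain ⟨C, rfl⟩ := exists_conjTranspose_mul_self hρ
  have h : reducedA ((Q ⊗ₖ (1 : Matrix B B ℂ)) * (Cᴴ * C) * (Q ⊗ₖ (1 : Matrix B B ℂ))ᴴ) =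
      Q * reducedA (Cᴴ * C) * Qᴴ := by
    generalize Cᴴ * C = X
    ext a a'
    simp only [reducedA, of_apply, mul_apply, Fintype.sum_prod_type, conjTranspose_apply,
      kroneckerMap_apply, one_apply]
    simp only [mul_ite, mul_one, mul_zero, ite_mul, zero_mul, Finset.sum_ite_eq, Finset.mem_univ,
      if_true, apply_ite star, star_zero, Finset.mul_sum, Finset.sum_mul]
    rw [Finset.sum_comm]
    refine Finset.sum_congr rfl fun u _ => ?_
    rw [Finset.sum_comm]
  have h' (X : Matrix (A × B) (A × B) ℂ) : X.trace = (reducedA X).trace := by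
    simp [trace, reducedA, Fintype.sum_prod_type]
  have h0 : ((Q ⊗ₖ (1 : Matrix B B ℂ)) * Cᴴ * ((Q ⊗ₖ (1 : Matrix B B ℂ)) * Cᴴ)ᴴ).trace = 0 := by
    rw [conjTranspose_mul, conjTranspose_conjTranspose, mul_assoc, ← mul_assoc Cᴴ, ← mul_assoc,
      h', h, hQ, zero_mul, trace_zero]
  rw [trace_mul_conjTranspose_self_eq_zero_iff] at h0
  rw [← mul_assoc, h0, zero_mul]

/-- Two states with orthogonal reduced states on Alice's side are told apart by a measurement of
Alice that does not disturb them. -/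
theorem exists_discriminating_measurement {A B : Type} [Fintype A] [Fintype B] [DecidableEq A]
    [DecidableEq B] {ρ : Bool → Matrix (A × B) (A × B) ℂ} (hρ : ∀ b, (ρ b).PosSemidef)
    (h : (reducedA (ρ true) * reducedA (ρ false)).trace = 0) :
    ∃ Q : Bool → Matrix A A ℂ, IsAdmissible Q ∧
      ∀ b c, (Q b ⊗ₖ (1 : Matrix B B ℂ)) * ρ c = if b = c then ρ c else 0 := by
  have hr b := posSemidef_reducedA (hρ b)
  obtain ⟨P, hP, hPP, h₁, h₂⟩ := exists_support_projection (hr true).isHermitian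
  have h₀ := h₂ _ (mul_eq_zero_of_trace_mul_eq_zero (hr true) (hr false) h)
  have ht : ((1 - P) ⊗ₖ (1 : Matrix B B ℂ)) * ρ true = 0 :=
    kronecker_one_mul_eq_zero (hρ true) (by rw [sub_mul, one_mul, h₁, sub_self])
  have hf : (P ⊗ₖ (1 : Matrix B B ℂ)) * ρ false = 0 := kronecker_one_mul_eq_zero (hρ false) h₀
  have hadd (c) : ((1 - P) ⊗ₖ (1 : Matrix B B ℂ)) * ρ c =
      ρ c - (P ⊗ₖ (1 : Matrix B B ℂ)) * ρ c := by
    have : (1 - P) ⊗ₖ (1 : Matrix B B ℂ) = 1 - P ⊗ₖ (1 : Matrix B B ℂ) := by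
      rw [← one_kronecker_one]
      ext x y
      simp only [kroneckerMap_apply, Matrix.sub_apply, sub_mul]
    rw [this, sub_mul, one_mul]
  refine ⟨fun b => if b then P else 1 - P, ?_, ?_⟩
  · simp [IsAdmissible, hP, hPP, mul_sub, sub_mul]
  · rintro (_ | _) (_ | _)
    · simp [hadd, hf]
    · simpa using ht
    · simpa using hf
    · rw [hadd] at ht
      simpa using (sub_eq_zero.1 ht).symm

/-! ### Concentration of the number of copies -/

theorem sum_prod_eq_one {w : Bool → ℝ} (hw : ∑ b, w b = 1) (n : ℕ) :
    ∑ g : Fin n → Bool, ∏ i, w (g i) = 1 := by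
  have := Finset.prod_univ_sum (fun _ : Fin n => Finset.univ) fun _ => w
  rw [Fintype.piFinset_univ] at this
  rw [← this, hw, Finset.prod_const_one]

/-- The variance of a sum of independent centred variables, for the product of a distribution on
two points. -/
theorem sum_prod_mul_sum_sq {w x : Bool → ℝ} (hw : ∑ b, w b = 1) (hx : ∑ b, w b * x b = 0)
    (n : ℕ) :
    ∑ g : Fin n → Bool, (∏ i, w (g i)) * (∑ i, x (g i)) ^ 2 = n * ∑ b, w b * x b ^ 2 := by
  induction n with
  | zero => simp
  | succ n ih =>
    rw [← (Fin.consEquiv fun _ => Bool).sum_comp, Fintype.sum_prod_type]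
    simp only [Fin.consEquiv_apply, Fin.prod_univ_succ, Fin.sum_univ_succ, Fin.cons_zero,
      Fin.cons_succ]
    have h (b : Bool) : ∑ g : Fin n → Bool, w b * (∏ i, w (g i)) * (x b + ∑ i, x (g i)) ^ 2 =
        w b * x b ^ 2 + 2 * (w b * x b) * ∑ g : Fin n → Bool, (∏ i, w (g i)) * ∑ i, x (g i) +
          w b * (n * ∑ b, w b * x b ^ 2) := by
      rw [← ih, ← mul_one (w b * x b ^ 2), ← sum_prod_eq_one hw n, Finset.mul_sum,
        Finset.mul_sum, Finset.mul_sum,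
        ← Finset.sum_add_distrib, ← Finset.sum_add_distrib]
      refine Finset.sum_congr rfl fun g _ => ?_
      ring
    simp only [h]
    rw [Finset.sum_add_distrib, Finset.sum_add_distrib, ← Finset.sum_mul, ← Finset.sum_mul,
      ← Finset.mul_sum, hx, hw]
    push_cast
    ring

/-- Chebyshev's inequality: with probability at least `1 - 1 / (δ² n)`, among `n` independent
trials with success probability `p` and failure probability `q` there are at least `(p - δ) n`
successes and `(q - δ) n` failures. -/
theorem le_sum_typical {w : Bool → ℝ} (hw0 : ∀ b, 0 ≤ w b) (hw : ∑ b, w b = 1) {δ : ℝ}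
    (hδ : 0 < δ) {n : ℕ} (hn : 0 < n) {m₁ m₂ : ℕ} (h₁ : m₁ ≤ (w true - δ) * n)
    (h₂ : m₂ ≤ (w false - δ) * n) :
    1 - 1 / (δ ^ 2 * n) ≤ ∑ g : Fin n → Bool, if m₁ ≤ Fintype.card {i // g i = true} ∧
      m₂ ≤ Fintype.card {i // g i = false} then ∏ i, w (g i) else 0 := by
  have hn' : (0 : ℝ) < n := by exact_mod_cast hn
  rw [Fintype.sum_bool] at hw
  -- `x` is the indicator of success minus its mean.
  let x : Bool → ℝ := fun b => if b then w false else -w true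
  have hvar := sum_prod_mul_sum_sq (w := w) (x := x) (by rwa [Fintype.sum_bool])
    (by simp [x]; ring) n
  have hv : ∑ b, w b * x b ^ 2 ≤ 1 := by
    simp only [x, Fintype.sum_bool, if_true, Bool.false_eq_true, if_false]
    have ht := hw0 true
    have hf := hw0 false
    have : w true * w false ^ 2 + w false * (-w true) ^ 2 =
        w true * w false * (w true + w false) := by
      ring
    rw [this, hw]
    nlinarith
  have hx (g : Fin n → Bool) : ∑ i, x (g i) = Fintype.card {i // g i = true} - w true * n ∧
      ∑ i, x (g i) = w false * n - Fintype.card {i // g i = false} := by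
    have h0 : Fintype.card {i // g i = true} + Fintype.card {i // g i = false} = n := by
      have := Fintype.card_subtype_compl fun i => g i = true
      have h' := Fintype.card_subtype_le fun i => g i = true
      simp only [Bool.not_eq_true, Fintype.card_fin] at this h'
      omega
    have hs : ∑ i, x (g i) = Fintype.card {i // g i = true} * w false -
        Fintype.card {i // g i = false} * w true := by
      simp only [x, Finset.sum_ite, Finset.sum_const, Fintype.card_subtype, Bool.not_eq_true]
      simp only [nsmul_eq_mul]
      ring
    have h0' : (Fintype.card {i // g i = true} : ℝ) + Fintype.card {i // g i = false} = n := by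
      exact_mod_cast h0
    have hwt : w true = 1 - w false := by linarith
    rw [hs, ← h0', hwt]
    constructor <;> ring
  have hpt (g : Fin n → Bool) : ∏ i, w (g i) ≤
      (if m₁ ≤ Fintype.card {i // g i = true} ∧ m₂ ≤ Fintype.card {i // g i = false} then
        ∏ i, w (g i) else 0) + (∏ i, w (g i)) * (∑ i, x (g i)) ^ 2 / (δ * n) ^ 2 := by
    have hg : 0 ≤ ∏ i, w (g i) := Finset.prod_nonneg fun i _ => hw0 _
    split_ifs with h
    · have : 0 ≤ (∏ i, w (g i)) * (∑ i, x (g i)) ^ 2 / (δ * n) ^ 2 := by positivity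
      linarith
    · have hd : (δ * n) ^ 2 ≤ (∑ i, x (g i)) ^ 2 := by
        rw [not_and_or, not_le, not_le] at h
        have hδn : 0 < δ * n := by positivity
        obtain h | h := h
        · have h' : (Fintype.card {i // g i = true} : ℝ) < m₁ := by exact_mod_cast h
          rw [(hx g).1]
          nlinarith
        · have h' : (Fintype.card {i // g i = false} : ℝ) < m₂ := by exact_mod_cast h
          rw [(hx g).2]
          nlinarith
      rw [zero_add, le_div_iff₀ (by positivity)]
      exact mul_le_mul_of_nonneg_left hd hg
  have hsum := Finset.sum_le_sum fun g (_ : g ∈ Finset.univ) => hpt g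
  rw [Finset.sum_add_distrib, ← Finset.sum_div, hvar,
    sum_prod_eq_one (by rwa [Fintype.sum_bool])] at hsum
  have hle : n * ∑ b, w b * x b ^ 2 ≤ (n : ℝ) := by nlinarith
  have : n * (∑ b, w b * x b ^ 2) / (δ * n) ^ 2 ≤ 1 / (δ ^ 2 * n) := by
    calc _ ≤ (n : ℝ) / (δ * n) ^ 2 := by gcongr
      _ = _ := by field_simp
  linarith

/-! ### Distillation from a mixture of two states -/

/-- The tensor power of a mixture is the mixture of the products of states over all label
sequences. -/
theorem tensorPower_mixture {A B : Type} (w : Bool → ℝ) (ρ : Bool → Matrix (A × B) (A × B) ℂ)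
    (n : ℕ) : tensorPower (∑ b, (w b : ℂ) • ρ b) n =
      ∑ g : Fin n → Bool, ((∏ i, w (g i) : ℝ) : ℂ) • tensorProd fun i => ρ (g i) := by
  ext x y
  have := Finset.prod_univ_sum (fun _ : Fin n => (Finset.univ : Finset Bool)) fun i b =>
    (w b : ℂ) * ρ b (x.1 i, x.2 i) (y.1 i, y.2 i)
  rw [Fintype.piFinset_univ] at this
  simpa [tensorPower, tensorProd, Matrix.sum_apply, Finset.prod_mul_distrib] using this

theorem overlap_sum_smul {k : ℕ} {ι : Type} [Fintype ι] (w : ι → ℝ)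
    (X : ι → Matrix ((Fin k → Fin 2) × (Fin k → Fin 2)) ((Fin k → Fin 2) × (Fin k → Fin 2)) ℂ) :
    overlap (∑ i, (w i : ℂ) • X i) = ∑ i, w i * overlap (X i) := by
  simp [overlap, Finset.sum_mul, trace_sum]

theorem isState_mixture {A ι : Type} [Fintype A] [Fintype ι] {w : ι → ℝ} (hw : ∀ i, 0 ≤ w i)
    (hw1 : ∑ i, w i = 1) {ρ : ι → Matrix A A ℂ} (hρ : ∀ i, IsState (ρ i)) :
    IsState (∑ i, (w i : ℂ) • ρ i) := by
  constructor
  · exact posSemidef_sum _ fun i _ => (hρ i).1.smul (by exact_mod_cast hw i)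
  · simp only [trace_sum, trace_smul, (hρ _).2, smul_eq_mul, mul_one]
    exact_mod_cast hw1

/-- One block of the protocol: measuring `n` copies of the mixture, distilling `m₁` and `m₂` sorted
copies separately, and keeping `k` pairs. -/
theorem exists_isLOCC_distill_mixture {A B : Type} [Fintype A] [Fintype B]
    {ρ : Bool → Matrix (A × B) (A × B) ℂ} (hρ : ∀ b, IsState (ρ b))
    (h : (reducedA (ρ true) * reducedA (ρ false)).trace = 0) {w : Bool → ℝ} (hw0 : ∀ b, 0 ≤ w b)
    (hw : ∑ b, w b = 1) {δ : ℝ} (hδ : 0 < δ) {n : ℕ} (hn : 0 < n) {m₁ m₂ k₁ k₂ k : ℕ}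
    (h₁ : m₁ ≤ (w true - δ) * n) (h₂ : m₂ ≤ (w false - δ) * n) (hk : k ≤ k₁ + k₂)
    {Φ : Matrix ((Fin m₁ → A) × (Fin m₁ → B)) ((Fin m₁ → A) × (Fin m₁ → B)) ℂ →ₗ[ℂ]
      Matrix ((Fin k₁ → Fin 2) × (Fin k₁ → Fin 2)) ((Fin k₁ → Fin 2) × (Fin k₁ → Fin 2)) ℂ}
    (hΦ : IsLOCC Φ)
    {Ψ : Matrix ((Fin m₂ → A) × (Fin m₂ → B)) ((Fin m₂ → A) × (Fin m₂ → B)) ℂ →ₗ[ℂ]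
      Matrix ((Fin k₂ → Fin 2) × (Fin k₂ → Fin 2)) ((Fin k₂ → Fin 2) × (Fin k₂ → Fin 2)) ℂ}
    (hΨ : IsLOCC Ψ) :
    ∃ Ξ : Matrix ((Fin n → A) × (Fin n → B)) ((Fin n → A) × (Fin n → B)) ℂ →ₗ[ℂ]
        Matrix ((Fin k → Fin 2) × (Fin k → Fin 2)) ((Fin k → Fin 2) × (Fin k → Fin 2)) ℂ,
      IsLOCC Ξ ∧ (1 - 1 / (δ ^ 2 * n)) *
        (overlap (Φ (tensorPower (ρ true) m₁)) * overlap (Ψ (tensorPower (ρ false) m₂))) ≤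
          overlap (Ξ (tensorPower (∑ b, (w b : ℂ) • ρ b) n)) := by
  classical
  have hmn : m₁ + m₂ ≤ n := by
    rw [Fintype.sum_bool] at hw
    have hn' : (0 : ℝ) < n := by exact_mod_cast hn
    have : (m₁ : ℝ) + m₂ ≤ n := by
      calc (m₁ : ℝ) + m₂ ≤ (w true - δ) * n + (w false - δ) * n := add_le_add h₁ h₂
        _ = (w true + w false) * n - 2 * (δ * n) := by ring
        _ ≤ n := by rw [hw]; nlinarith [mul_pos hδ hn']
    exact_mod_cast this
  obtain ⟨r, hr⟩ := Nat.exists_eq_add_of_le hmn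
  obtain ⟨Q, hQ, hQρ⟩ := exists_discriminating_measurement (fun b => (hρ b).1) h
  obtain ⟨Ξ₁, hΞ₁, hsort⟩ := exists_isLOCC_sort hr hQ hQρ hρ
  obtain ⟨Ξ₂, hΞ₂, hprod⟩ := exists_isLOCC_bipartiteProd hΦ hΨ
  obtain ⟨Ξ₃, hΞ₃, hdisc⟩ := exists_isLOCC_discard_pairs hk
  have hX := hΦ.posSemidef (isState_tensorProd fun _ : Fin m₁ => hρ true).1
  have hY := hΨ.posSemidef (isState_tensorProd fun _ : Fin m₂ => hρ false).1
  rw [← tensorPower_eq_tensorProd] at hX hY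
  have hΞ := (hΞ₁.comp _ _ hΞ₂).comp _ _ hΞ₃
  refine ⟨_, hΞ, ?_⟩
  rw [tensorPower_mixture, map_sum]
  simp only [map_smul]
  rw [overlap_sum_smul]
  refine (mul_le_mul_of_nonneg_right (le_sum_typical hw0 hw hδ hn h₁ h₂)
    (mul_nonneg (overlap_nonneg hX) (overlap_nonneg hY))).trans ?_
  rw [Finset.sum_mul]
  refine Finset.sum_le_sum fun g _ => ?_
  have hg : 0 ≤ ∏ i, w (g i) := Finset.prod_nonneg fun i _ => hw0 _
  split_ifs with ht
  · refine mul_le_mul_of_nonneg_left ?_ hg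
    simp only [LinearMap.comp_apply, hsort g ht.1 ht.2, hprod]
    exact hdisc _ _ hX hY
  · rw [zero_mul]
    exact mul_nonneg hg (overlap_nonneg (hΞ.posSemidef (isState_tensorProd fun i => hρ (g i)).1))

/-- Every rate below the weighted sum of achievable rates of two states, orthogonal on Alice's
side, is achievable for their mixture. -/
theorem isDistillationRate_mixture {A B : Type} [Fintype A] [Fintype B]
    {ρ : Bool → Matrix (A × B) (A × B) ℂ} (hρ : ∀ b, IsState (ρ b))
    (h : (reducedA (ρ true) * reducedA (ρ false)).trace = 0) {w : Bool → ℝ} (hw0 : ∀ b, 0 < w b)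
    (hw : ∑ b, w b = 1) {α : Bool → ℝ≥0} (hα : ∀ b, IsDistillationRate (ρ b) (α b)) {β : ℝ≥0}
    (hβ : β < ∑ b, w b * α b) : IsDistillationRate (∑ b, (w b : ℂ) • ρ b) β := by
  have hmix := isState_mixture (fun b => (hw0 b).le) hw hρ
  rw [isDistillationRate_iff hmix]
  choose Φ hΦ hlim using fun b => (isDistillationRate_iff (hρ b) (α b)).1 (hα b)
  obtain ⟨δ, hδ, hδw, hδβ⟩ : ∃ δ : ℝ, 0 < δ ∧ (∀ b, δ < w b) ∧ β < ∑ b, (w b - δ) * α b := by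
    have hc : Filter.Tendsto (fun δ : ℝ => ∑ b, (w b - δ) * α b) (nhdsWithin 0 (Set.Ioi 0))
        (nhds (∑ b, (w b - 0) * α b)) :=
      Filter.Tendsto.mono_left (Continuous.tendsto (by fun_prop) 0) nhdsWithin_le_nhds
    have h1 := hc.eventually_const_lt (u := (β : ℝ)) (by simpa using hβ)
    have h2 : ∀ᶠ δ : ℝ in nhdsWithin 0 (Set.Ioi 0), ∀ b, δ < w b :=
      Filter.eventually_all.2 fun b => nhdsWithin_le_nhds (eventually_lt_nhds (hw0 b))
    obtain ⟨δ, ⟨h, h'⟩, h''⟩ := ((h1.and h2).and self_mem_nhdsWithin).exists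
    exact ⟨δ, h'', h', h⟩
  -- The number of sorted copies of each state that are distilled, out of `n` copies of the mixture.
  let m (b : Bool) (n : ℕ) : ℕ := ⌊(w b - δ) * n⌋₊
  have hm (b : Bool) (n : ℕ) : (m b n : ℝ) ≤ (w b - δ) * n :=
    Nat.floor_le (mul_nonneg (sub_nonneg.2 (hδw b).le) n.cast_nonneg)
  have hm_lim (b : Bool) : Filter.Tendsto (m b) Filter.atTop Filter.atTop :=
    tendsto_nat_floor_atTop.comp
      (tendsto_natCast_atTop_atTop.const_mul_atTop (sub_pos.2 (hδw b)))
  -- The roundings lose at most `α true + α false + 2` pairs, which the surplus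
  -- `(∑ b, (w b - δ) α b - β) n` exceeds for large `n`.
  have hpairs : ∀ᶠ n : ℕ in Filter.atTop,
      ⌊β * n⌋₊ ≤ ⌊α true * m true n⌋₊ + ⌊α false * m false n⌋₊ := by
    rw [Fintype.sum_bool] at hδβ
    have h1 : Filter.Tendsto (fun n : ℕ => ((w true - δ) * α true + (w false - δ) * α false - β) *
        (n : ℝ)) Filter.atTop Filter.atTop :=
      tendsto_natCast_atTop_atTop.const_mul_atTop (sub_pos.2 hδβ)
    filter_upwards [h1.eventually_ge_atTop ((α true : ℝ) + α false + 2)] with n hn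
    have hfl (b : Bool) : (w b - δ) * n < m b n + 1 := Nat.lt_floor_add_one _
    have hfl' (b : Bool) : (α b : ℝ) * m b n < ⌊α b * m b n⌋₊ + 1 := by
      exact_mod_cast Nat.lt_floor_add_one (α b * m b n)
    have hmul (b : Bool) : α b * ((w b - δ) * n) ≤ α b * (m b n + 1 : ℝ) :=
      mul_le_mul_of_nonneg_left (hfl b).le (α b).coe_nonneg
    have hβn : (⌊β * n⌋₊ : ℝ) ≤ β * n := by
      exact_mod_cast Nat.floor_le (zero_le (a := β * n))
    have : (⌊β * n⌋₊ : ℝ) ≤ (⌊α true * m true n⌋₊ + ⌊α false * m false n⌋₊ : ℕ) := by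
      push_cast
      linarith [hfl' true, hfl' false, hmul true, hmul false]
    exact_mod_cast this
  have hex (n : ℕ) : ∃ Ξ : Matrix ((Fin n → A) × (Fin n → B)) ((Fin n → A) × (Fin n → B)) ℂ →ₗ[ℂ]
      Matrix ((Fin ⌊β * n⌋₊ → Fin 2) × (Fin ⌊β * n⌋₊ → Fin 2))
        ((Fin ⌊β * n⌋₊ → Fin 2) × (Fin ⌊β * n⌋₊ → Fin 2)) ℂ,
      IsLOCC Ξ ∧ (0 < n → ⌊β * n⌋₊ ≤ ⌊α true * m true n⌋₊ + ⌊α false * m false n⌋₊ →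
        (1 - 1 / (δ ^ 2 * n)) * (overlap (Φ true (m true n) (tensorPower (ρ true) (m true n))) *
          overlap (Φ false (m false n) (tensorPower (ρ false) (m false n)))) ≤
            overlap (Ξ (tensorPower (∑ b, (w b : ℂ) • ρ b) n))) := by
    -- For the finitely many `n` with too few pairs any local operation will do.
    by_cases hn : 0 < n ∧ ⌊β * n⌋₊ ≤ ⌊α true * m true n⌋₊ + ⌊α false * m false n⌋₊
    · obtain ⟨Ξ, hΞ, hov⟩ := exists_isLOCC_distill_mixture hρ h (fun b => (hw0 b).le) hw hδ hn.1
        (hm true n) (hm false n) hn.2 (hΦ true (m true n)) (hΦ false (m false n))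
      exact ⟨Ξ, hΞ, fun _ _ => hov⟩
    · obtain ⟨Ξ, hΞ⟩ := exists_isLOCC (Fin n → A) (Fin n → B) (Fin ⌊β * n⌋₊ → Fin 2)
        (Fin ⌊β * n⌋₊ → Fin 2)
      exact ⟨Ξ, hΞ, fun h h' => (hn ⟨h, h'⟩).elim⟩
  choose Ξ hΞ hov using hex
  refine ⟨Ξ, hΞ, ?_⟩
  have hlow : Filter.Tendsto (fun n : ℕ => (1 - 1 / (δ ^ 2 * n)) *
      (overlap (Φ true (m true n) (tensorPower (ρ true) (m true n))) *
        overlap (Φ false (m false n) (tensorPower (ρ false) (m false n))))) Filter.atTop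
      (nhds ((1 - 0) * (1 * 1))) := by
    refine Filter.Tendsto.mul (tendsto_const_nhds.sub ?_)
      (((hlim true).comp (hm_lim true)).mul ((hlim false).comp (hm_lim false)))
    exact Filter.Tendsto.div_atTop tendsto_const_nhds
      (tendsto_natCast_atTop_atTop.const_mul_atTop (by positivity))
  rw [sub_zero, one_mul, one_mul] at hlow
  refine tendsto_of_tendsto_of_tendsto_of_le_of_le' hlow tendsto_const_nhds ?_
    (Filter.Eventually.of_forall fun n =>
      overlap_le_one ((hΞ n).isState (isState_tensorProd fun _ => hmix)))
  filter_upwards [hpairs, Filter.eventually_gt_atTop 0] with n hn hn0 using hov n hn0 hn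

/-- To the rate `0` belongs the one-dimensional target, on which the only state is `τ^{⊗0}`. -/
theorem isDistillationRate_zero {A B : Type} [Fintype A] [Fintype B]
    {ρ : Matrix (A × B) (A × B) ℂ} (hρ : IsState ρ) : IsDistillationRate ρ 0 := by
  rw [isDistillationRate_iff hρ]
  choose Φ hΦ using fun n : ℕ => exists_isLOCC (Fin n → A) (Fin n → B)
    (Fin ⌊(0 : ℝ≥0) * n⌋₊ → Fin 2) (Fin ⌊(0 : ℝ≥0) * n⌋₊ → Fin 2)
  refine ⟨Φ, hΦ, tendsto_const_nhds.congr fun n => ?_⟩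
  have hk : ⌊(0 : ℝ≥0) * n⌋₊ = 0 := by simp
  have hs := (hΦ n).isState (isState_tensorProd fun _ : Fin n => hρ)
  have h1 : tensorPower tau ⌊(0 : ℝ≥0) * n⌋₊ = 1 := by
    have : IsEmpty (Fin ⌊(0 : ℝ≥0) * n⌋₊) := by rw [hk]; infer_instance
    ext x y
    rw [Subsingleton.elim x y]
    simp [tensorPower]
  rw [overlap, h1, mul_one, tensorPower_eq_tensorProd, hs.2, Complex.one_re]

theorem isDistillationRate_swap {A B : Type} [Fintype A] [Fintype B]
    {ρ : Matrix (A × B) (A × B) ℂ} (hρ : IsState ρ) {α : ℝ≥0} (h : IsDistillationRate ρ α) :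
    IsDistillationRate (swapOp A B ρ) α := by
  have hs : IsState (swapOp A B ρ) := ⟨hρ.1.submatrix _, (trace_submatrix_swap ρ).trans hρ.2⟩
  rw [isDistillationRate_iff hρ] at h
  rw [isDistillationRate_iff hs]
  obtain ⟨Φ, hΦ, hlim⟩ := h
  refine ⟨_, fun n => (hΦ n).swap, hlim.congr fun n => ?_⟩
  have h (k : ℕ)
      (X : Matrix ((Fin k → Fin 2) × (Fin k → Fin 2)) ((Fin k → Fin 2) × (Fin k → Fin 2)) ℂ) :
      overlap X = overlap (swapOp _ _ X) := by
    have ht : tensorPower tau k = (tensorPower tau k).submatrix Prod.swap Prod.swap := by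
      ext x y
      simp [tensorPower_tau_apply, eq_comm]
    have hm : (X * tensorPower tau k).submatrix Prod.swap Prod.swap =
        swapOp _ _ X * tensorPower tau k := by
      conv_rhs => rw [ht]
      exact (submatrix_mul_equiv X _ Prod.swap (Equiv.prodComm _ _) Prod.swap).symm
    rw [overlap, overlap, ← hm, trace_submatrix_swap]
  exact h _ _

theorem distillableEntanglement_swap {A B : Type} [Fintype A] [Fintype B]
    {ρ : Matrix (A × B) (A × B) ℂ} (hρ : IsState ρ) :
    distillableEntanglement (swapOp A B ρ) = distillableEntanglement ρ := by
  have hs : IsState (swapOp A B ρ) := ⟨hρ.1.submatrix _, (trace_submatrix_swap ρ).trans hρ.2⟩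
  refine iSup_congr fun α => iSup_congr_Prop ⟨fun h => ?_, isDistillationRate_swap hρ⟩ fun _ => rfl
  exact isDistillationRate_swap hs h

theorem IsDistillationRate.le {A B : Type} {ρ : Matrix (A × B) (A × B) ℂ} {α : ℝ≥0}
    (h : IsDistillationRate ρ α) : (α : ℝ≥0∞) ≤ distillableEntanglement ρ :=
  le_iSup₂_of_le α h le_rfl

theorem le_distillableEntanglement_mixture_of_reducedA {A B : Type} [Fintype A] [Fintype B]
    {ρ : Bool → Matrix (A × B) (A × B) ℂ} (hρ : ∀ b, IsState (ρ b))
    (h : (reducedA (ρ true) * reducedA (ρ false)).trace = 0) {w : Bool → ℝ} (hw0 : ∀ b, 0 < w b)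
    (hw : ∑ b, w b = 1) :
    ∑ b, ENNReal.ofReal (w b) * distillableEntanglement (ρ b) ≤
      distillableEntanglement (∑ b, (w b : ℂ) • ρ b) := by
  have hsup (b : Bool) : ENNReal.ofReal (w b) * distillableEntanglement (ρ b) =
      ⨆ (α : ℝ≥0) (_ : IsDistillationRate (ρ b) α), ENNReal.ofReal (w b) * α := by
    simp only [distillableEntanglement, ENNReal.mul_iSup]
  rw [Fintype.sum_bool, hsup, hsup]
  refine ENNReal.biSup_add_biSup_le' ⟨0, isDistillationRate_zero (hρ true)⟩
    ⟨0, isDistillationRate_zero (hρ false)⟩ fun a ha a' ha' =>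
      ENNReal.le_of_forall_nnreal_lt fun β hβ => ?_
  let α : Bool → ℝ≥0 := fun b => bif b then a else a'
  have hα (b : Bool) : IsDistillationRate (ρ b) (α b) := by cases b <;> assumption
  have hlt : (β : ℝ) < ∑ b, w b * (α b : ℝ) := by
    rw [Fintype.sum_bool]
    change (β : ℝ) < w true * a + w false * a'
    rw [← ENNReal.ofReal_coe_nnreal (p := a), ← ENNReal.ofReal_coe_nnreal (p := a'),
      ← ENNReal.ofReal_coe_nnreal (p := β), ← ENNReal.ofReal_mul (hw0 _).le,
      ← ENNReal.ofReal_mul (hw0 _).le,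
      ← ENNReal.ofReal_add (mul_nonneg (hw0 _).le a.coe_nonneg)
        (mul_nonneg (hw0 _).le a'.coe_nonneg)] at hβ
    exact (ENNReal.ofReal_lt_ofReal_iff'.1 hβ).1
  exact (isDistillationRate_mixture hρ h hw0 hw hα hlt).le

/-- The theorem for two states with positive weights. -/
theorem le_distillableEntanglement_mixture {A B : Type} [Fintype A] [Fintype B]
    {ρ : Bool → Matrix (A × B) (A × B) ℂ} (hρ : ∀ b, IsState (ρ b))
    (h : (reducedA (ρ true) * reducedA (ρ false)).trace = 0 ∨
      (reducedB (ρ true) * reducedB (ρ false)).trace = 0) {w : Bool → ℝ} (hw0 : ∀ b, 0 < w b)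
    (hw : ∑ b, w b = 1) :
    ∑ b, ENNReal.ofReal (w b) * distillableEntanglement (ρ b) ≤
      distillableEntanglement (∑ b, (w b : ℂ) • ρ b) := by
  obtain h | h := h
  · exact le_distillableEntanglement_mixture_of_reducedA hρ h hw0 hw
  · have hs (b) : IsState (swapOp A B (ρ b)) :=
      ⟨(hρ b).1.submatrix _, (trace_submatrix_swap _).trans (hρ b).2⟩
    have := le_distillableEntanglement_mixture_of_reducedA hs h hw0 hw
    simpa only [distillableEntanglement_swap (hρ _), ← map_smul, ← map_sum,
      distillableEntanglement_swap (isState_mixture (fun b => (hw0 b).le) hw hρ)] using this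

/-! ### Locally orthogonal families -/

/-- Orthogonality of reduced states passes to linear combinations. -/
theorem trace_reducedA_mul_sum {A B ι : Type} [Fintype A] [Fintype B] [Fintype ι]
    (X : Matrix (A × B) (A × B) ℂ) (c : ι → ℂ) (ρ : ι → Matrix (A × B) (A × B) ℂ)
    (h : ∀ i, (reducedA X * reducedA (ρ i)).trace = 0) :
    (reducedA X * reducedA (∑ i, c i • ρ i)).trace = 0 := by
  have : reducedA (∑ i, c i • ρ i) = ∑ i, c i • reducedA (ρ i) := by
    ext a a'
    simp only [reducedA, of_apply, Matrix.sum_apply, Matrix.smul_apply, Finset.smul_sum]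
    exact Finset.sum_comm
  simp [this, Matrix.mul_sum, trace_sum, h]

/-- The theorem for a family listed in the order of local orthogonality. -/
theorem sum_le_distillableEntanglement {A B : Type} [Fintype A] [Fintype B] {K : ℕ}
    {w : Fin K → ℝ} (hw0 : ∀ i, 0 ≤ w i) (hw : ∑ i, w i = 1)
    {ρ : Fin K → Matrix (A × B) (A × B) ℂ} (hρ : ∀ i, IsState (ρ i))
    (horth : ∀ q, (∀ n, q < n → (reducedA (ρ q) * reducedA (ρ n)).trace = 0) ∨
      (∀ n, q < n → (reducedB (ρ q) * reducedB (ρ n)).trace = 0)) :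
    ∑ i, ENNReal.ofReal (w i) * distillableEntanglement (ρ i) ≤
      distillableEntanglement (∑ i, (w i : ℂ) • ρ i) := by
  induction K with
  | zero => simp at hw
  | succ K ih =>
    rw [Fin.sum_univ_succ] at hw ⊢
    rw [Fin.sum_univ_succ (f := fun i => (w i : ℂ) • ρ i)]
    set q := ∑ i : Fin K, w i.succ with hq
    have hq0 : 0 ≤ q := Finset.sum_nonneg fun i _ => hw0 _
    obtain hq' | hq' := hq0.eq_or_lt
    · have hz (i : Fin K) : w i.succ = 0 :=
        (Finset.sum_eq_zero_iff_of_nonneg fun i _ => hw0 _).1 hq'.symm i (Finset.mem_univ i)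
      have h1 : w 0 = 1 := by linarith
      simp [hz, h1]
    -- The later states are combined into one normalized state.
    set σ := ∑ i : Fin K, ((w i.succ / q : ℝ) : ℂ) • ρ i.succ with hσ
    have hv0 (i : Fin K) : 0 ≤ w i.succ / q := div_nonneg (hw0 _) hq0
    have hv : ∑ i : Fin K, w i.succ / q = 1 := by
      rw [← Finset.sum_div, ← hq, div_self hq'.ne']
    have hσs : IsState σ := isState_mixture hv0 hv fun i => hρ _
    have hih := ih hv0 hv (fun i => hρ i.succ) fun i =>
      (horth i.succ).imp (fun h n hn => h n.succ (Fin.succ_lt_succ_iff.2 hn))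
        fun h n hn => h n.succ (Fin.succ_lt_succ_iff.2 hn)
    have hsum : ∑ i : Fin K, (w i.succ : ℂ) • ρ i.succ = (q : ℂ) • σ := by
      rw [hσ, Finset.smul_sum]
      refine Finset.sum_congr rfl fun i _ => ?_
      rw [smul_smul, ← Complex.ofReal_mul, mul_div_cancel₀ _ hq'.ne']
    have htail : ∑ i : Fin K, ENNReal.ofReal (w i.succ) * distillableEntanglement (ρ i.succ) ≤
        ENNReal.ofReal q * distillableEntanglement σ := by
      refine le_trans (le_of_eq ?_) (mul_le_mul_right hih (ENNReal.ofReal q))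
      rw [Finset.mul_sum]
      refine Finset.sum_congr rfl fun i _ => ?_
      rw [← mul_assoc, ← ENNReal.ofReal_mul hq0, mul_div_cancel₀ _ hq'.ne']
    rw [hsum]
    obtain h0 | h0 := (hw0 0).eq_or_lt
    · have h1 : q = 1 := by linarith
      simpa [← h0, h1] using htail
    refine (add_le_add_right htail _).trans ?_
    have horth0 := (horth 0).imp
      (fun h => trace_reducedA_mul_sum (ρ 0) (fun i : Fin K => ((w i.succ / q : ℝ) : ℂ))
        (fun i => ρ i.succ) fun i => h i.succ i.succ_pos)
      (fun h => trace_reducedA_mul_sum (swapOp A B (ρ 0))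
        (fun i : Fin K => ((w i.succ / q : ℝ) : ℂ))
        (fun i => swapOp A B (ρ i.succ)) fun i => h i.succ i.succ_pos)
    simp only [← map_smul, ← map_sum] at horth0
    have := le_distillableEntanglement_mixture (ρ := fun b => bif b then ρ 0 else σ)
      (w := fun b => bif b then w 0 else q)
      (by rintro (_ | _) <;> simp [hρ, hσs]) (by exact horth0)
      (by rintro (_ | _) <;> assumption) (by simpa using hw)
    simpa using this

end Entanglement

theorem theorem3p4 {A B S : Type} [Fintype A] [Fintype B]
    [Fintype S] (p : S → ℝ) (hp_nonneg : ∀ a, 0 ≤ p a) (hp_sum : ∑ a, p a = 1)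
    (ρ : Matrix (A × B) (A × B) ℂ) (ρs : S → Matrix (A × B) (A × B) ℂ)
    (hρs : ∀ a, Entanglement.IsState (ρs a))
    (horth : Entanglement.LocallyOrthogonal ρs)
    (hρ : ρ = ∑ a, (p a : ℂ) • ρs a) :
    ∑ a, ENNReal.ofReal (p a) * Entanglement.distillableEntanglement (ρs a) ≤
      Entanglement.distillableEntanglement ρ := by
  obtain ⟨e, he⟩ := horth
  have h := Entanglement.sum_le_distillableEntanglement (fun i => hp_nonneg (e i))
    ((e.sum_comp p).trans hp_sum) (fun i => hρs (e i)) he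
  rwa [e.sum_comp fun a => ENNReal.ofReal (p a) * Entanglement.distillableEntanglement (ρs a),
    e.sum_comp fun a => (p a : ℂ) • ρs a, ← hρ] at h
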